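/- Let $\alpha\in(0,1)$ and let $g:\mathbb{R}\setminus\{0\}\to[0,\infty)$ be smooth, vanishing outside $[-1,1]$, with $\int_{\mathbb{R}}(z^2\wedge 1)\,g(z)\,dz<\infty$ and $g(z)=C/|z|^{1+\alpha}$ in a punctured neighbourhood of $0$ for some constant $C>0$. Let $\gamma:\mathbb{R}\to\mathbb{R}^d$ be a smooth curve with bounded derivatives of each order $\ge 1$, with $\gamma(0)=0$, such that for some $k$ the vectors $\frac{d^l}{dz^l}\gamma(0)$, $l\le k$, span $\mathbb{R}^d$. Let $\mu$ be the image of the measure $g(z)\,dz$ under $\gamma$. Define $$H(\xi)=\int_{\mathbb{R}^d}\bigl(e^{\langle z',\xi\rangle}-1\bigr)\,\mu(dz'),\qquad L(a)=\sup_{\xi\in\mathbb{R}^d}\{\langle a,\xi\rangle-H(\xi)\}\in[0,\infty],$$ $$l(x,y)=\inf\Bigl\{\int_0^1 L(\dot\phi(t))\,dt\;:\;\phi:[0,1]\to\mathbb{R}^d\text{ piecewise }C^1,\ \phi(0)=x,\ \phi(1)=y\Bigr\}\in[0,\infty].$$ For $h>0$ let $L^hf(x)=\int_{\mathbb{R}^d}(f(x+hz')-f(x))\,\mu(dz')$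 for $f\in C_b^\infty(\mathbb{R}^d)$, the smooth functions that are bounded together with all their derivatives. Then for each $h>0$ there is exactly one semigroup $(P^h_t)_{t\ge 0}$ of Markov kernels on $\mathbb{R}^d$ such that $t^{-1}(P^h_tf-f)\to\frac1h L^hf$ uniformly on $\mathbb{R}^d$ as $t\downarrow 0$, for every $f\in C_b^\infty(\mathbb{R}^d)$. Moreover, for every $x\in\mathbb{R}^d$ and every open ball $O\subset\mathbb{R}^d$ of finite positive radius, $$\limsup_{h\downarrow 0}\,h\log P^h_1[1_O](x)\;\le\;-\inf_{y\in O}l(x,y),$$ with the conventions $\log 0=-\infty$ and $-(+\infty)=-\infty$. -/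

import Mathlib

open MeasureTheory ProbabilityTheory Filter Topology Set
open scoped NNReal ENNReal ContDiff InnerProductSpace

namespace JumpLD

noncomputable section

/-- The space `C_b^∞(ℝ^d)`: smooth real functions, bounded together with all their derivatives. -/
def IsCbInfty {d : ℕ} (f : EuclideanSpace ℝ (Fin d) → ℝ) : Prop :=
  ContDiff ℝ ∞ f ∧ ∀ n : ℕ, ∃ C : ℝ, ∀ x, ‖iteratedFDeriv ℝ n f x‖ ≤ C

/-- Smooth curves in `ℝ^d`, starting at the origin, with bounded derivatives of each order. -/
def IsAdmissibleCurve {d : ℕ} (γ : ℝ → EuclideanSpace ℝ (Fin d)) : Prop :=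
  ContDiff ℝ ∞ γ ∧ (∀ n : ℕ, 1 ≤ n → ∃ C : ℝ, ∀ z, ‖iteratedDeriv n γ z‖ ≤ C) ∧ γ 0 = 0

/-- For some `k`, the derivatives at `0` of order at most `k` span `ℝ^d`. -/
def HypothesisH {d : ℕ} (γ : ℝ → EuclideanSpace ℝ (Fin d)) : Prop :=
  ∃ k : ℕ, Submodule.span ℝ ((fun l : ℕ => iteratedDeriv l γ 0) '' {l | l ≤ k}) = ⊤

/-- The densities `g` on `ℝ \ {0}`: smooth, nonnegative, vanishing outside `[-1,1]`, with
`∫ (z² ∧ 1) g(z) dz < ∞`, and equal to `C / |z|^(1+α)` near `0`. The value `g 0` is irrelevant. -/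
structure IsJumpDensity (α : ℝ) (g : ℝ → ℝ) : Prop where
  smooth : ContDiffOn ℝ ∞ g {0}ᶜ
  nonneg : ∀ z, z ≠ 0 → 0 ≤ g z
  support : ∀ z, 1 < |z| → g z = 0
  integrable : Integrable (fun z => min (z ^ 2) 1 * g z)
  near_zero : ∃ C : ℝ, 0 < C ∧ ∀ᶠ z in 𝓝[≠] (0 : ℝ), g z = C / |z| ^ (1 + α)

/-- The Lévy measure: the image of `g(z) dz` under `γ`. -/
def levyMeasure {d : ℕ} (γ : ℝ → EuclideanSpace ℝ (Fin d)) (g : ℝ → ℝ) :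
    Measure (EuclideanSpace ℝ (Fin d)) :=
  (volume.withDensity (fun z => ENNReal.ofReal (g z))).map γ

/-- The rescaled operator `L^h f(x) = ∫ (f(x + h z') - f(x)) μ(dz')`. -/
def jumpOp {d : ℕ} (μ : Measure (EuclideanSpace ℝ (Fin d))) (h : ℝ)
    (f : EuclideanSpace ℝ (Fin d) → ℝ) (x : EuclideanSpace ℝ (Fin d)) : ℝ :=
  ∫ z, (f (x + h • z) - f x) ∂μ

/-- `P` is a semigroup of Markov kernels on `ℝ^d` whose generator is `A` on `C_b^∞(ℝ^d)`
(the derivative at time `0+` being taken in the uniform norm). -/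
structure IsMarkovSemigroupOf {d : ℕ}
    (A : (EuclideanSpace ℝ (Fin d) → ℝ) → EuclideanSpace ℝ (Fin d) → ℝ)
    (P : ℝ≥0 → Kernel (EuclideanSpace ℝ (Fin d)) (EuclideanSpace ℝ (Fin d))) : Prop where
  markov : ∀ t, IsMarkovKernel (P t)
  zero : P 0 = Kernel.id
  add : ∀ s t, P (s + t) = P t ∘ₖ P s
  generator : ∀ f, IsCbInfty f →
    TendstoUniformly (fun (t : ℝ≥0) x => (t : ℝ)⁻¹ * (∫ y, f y ∂(P t x) - f x)) (A f) (𝓝[>] 0)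

/-- The Hamiltonian `H(ξ) = ∫ (exp⟨z', ξ⟩ - 1) μ(dz')`. -/
def hamiltonian {d : ℕ} (μ : Measure (EuclideanSpace ℝ (Fin d)))
    (ξ : EuclideanSpace ℝ (Fin d)) : ℝ :=
  ∫ z, (Real.exp ⟪z, ξ⟫_ℝ - 1) ∂μ

/-- The Legendre transform of the Hamiltonian, as an extended real number. -/
def lagrangian {d : ℕ} (μ : Measure (EuclideanSpace ℝ (Fin d)))
    (a : EuclideanSpace ℝ (Fin d)) : EReal :=
  ⨆ ξ : EuclideanSpace ℝ (Fin d), ((⟪a, ξ⟫_ℝ - hamiltonian μ ξ : ℝ) : EReal)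

/-- The Legendre transform is nonnegative, so that `EReal.toENNReal` does not change it below. -/
theorem lagrangian_nonneg {d : ℕ} (μ : Measure (EuclideanSpace ℝ (Fin d)))
    (a : EuclideanSpace ℝ (Fin d)) : 0 ≤ lagrangian μ a := by
  refine le_trans ?_ (le_iSup _ (0 : EuclideanSpace ℝ (Fin d)))
  simp [hamiltonian]

/-- Piecewise `C¹` curves on `[0,1]`: there is a subdivision `0 = t₀ < ⋯ < tₙ = 1` such that `φ` is
`C¹` on each closed interval of it (hence continuous on `[0,1]`). -/
def IsPiecewiseC1 {d : ℕ} (φ : ℝ → EuclideanSpace ℝ (Fin d)) : Prop :=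
  ∃ (n : ℕ) (t : Fin (n + 1) → ℝ), StrictMono t ∧ t 0 = 0 ∧ t (Fin.last n) = 1 ∧
    ∀ i : Fin n, ContDiffOn ℝ 1 φ (Icc (t i.castSucc) (t i.succ))

/-- The action `S(φ) = ∫₀¹ L(dφ/dt) dt`, with values in `[0,∞]`. -/
def action {d : ℕ} (μ : Measure (EuclideanSpace ℝ (Fin d)))
    (φ : ℝ → EuclideanSpace ℝ (Fin d)) : ℝ≥0∞ :=
  ∫⁻ t in Icc (0 : ℝ) 1, (lagrangian μ (deriv φ t)).toENNReal

/-- `l(x,y)`: the infimum of the action over piecewise `C¹` curves from `x` to `y`. -/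
def cost {d : ℕ} (μ : Measure (EuclideanSpace ℝ (Fin d)))
    (x y : EuclideanSpace ℝ (Fin d)) : ℝ≥0∞ :=
  ⨅ (φ : ℝ → EuclideanSpace ℝ (Fin d)) (_ : IsPiecewiseC1 φ ∧ φ 0 = x ∧ φ 1 = y), action μ φ

end

end JumpLD

/-!
Since `α < 1` and the jumps are bounded, the Lévy measure `μ` integrates `‖z‖` and all the functions
`exp ⟪z, ξ⟫ - 1`. The operator `h⁻¹ L^h` is therefore the generator of a pure jump Lévy process
without compensation, with Lévy measure `m = h⁻¹ • (image of μ under z ↦ h z)`, and everything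
reduces to the laws `ν_t` with characteristic function `exp (t ∫ (exp (i ⟪z, ξ⟫) - 1) dm)`
(`IsLevyLaw`). Such a law is the weak limit of the compound Poisson laws of the jumps of norm larger
than `1 / (n + 1)` (`exists_isLevyLaw`); lower semicontinuity along this approximation gives the
bounds on its first moment and on its exponential moments.

*Uniqueness.* Characters are eigenfunctions of the generator, with eigenvalue
`ψ = ∫ (exp (i ⟪z, ξ⟫) - 1) dm`. For any semigroup with this generator, `P_s` maps a character to
`exp (s ψ)` times itself up to a uniform error `o(s)`, and as `‖exp (s ψ)‖ ≤ 1` the errors over the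
`n` steps of length `t / n` add up to `n o(t / n)`. Hence the generator determines the
characteristic functions (`IsMarkovSemigroupOf.charFun_eq`).

*Existence.* The translates of the laws `ν_t` form a semigroup. For the generator, `ν_t` is the
convolution of the compound Poisson law of the large jumps, which is expanded to first order in `t`,
and of a law with first moment at most `t ε_n`, where `ε_n` is the first moment of `m` on the jumps of
norm at most `1 / (n + 1)` (`IsLevyLaw.abs_integral_sub_le`).

*Upper bound.* It holds for each `h`, before any limit. If `K` is compact and convex, and each of its
points `y` satisfies `b < ⟪y, ξ⟫ - ∫ (exp ⟪z, ξ⟫ - 1) dm` for some `ξ`, then a finite cover by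
half-spaces and the exponential Chebyshev inequality bound the probability that the mean of `n`
independent copies lies in `K` by `N exp (-n b)`. That probability is at least `ν(K) ^ n` because `K`
is convex, so that `ν(K) ≤ exp (-b)` (`IsLevyLaw.measure_le_of_isCompact_of_convex`). Exhausting the
open ball `O` by compact balls gives `h log P^h_1(x, O) ≤ - inf_{y ∈ O} L(y - x)`, and
`l(x, y) ≤ L(y - x)` because the segment from `x` to `y` has action `L(y - x)`
(`cost_le_lagrangian`).
-/

namespace JumpLD

noncomputable section

/-! ### Compound Poisson laws -/

section CompoundPoisson

variable {E : Type*} [NormedAddCommGroup E] [MeasurableSpace E]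

/-- The `k`-fold convolution power of a measure. -/
def convPow (m : Measure E) : ℕ → Measure E
  | 0 => Measure.dirac 0
  | k + 1 => m ∗ convPow m k

/-- The compound Poisson law with finite jump measure `m`: the law of the sum of a Poisson number
(of mean the mass of `m`) of independent jumps distributed according to the normalised `m`. -/
def compoundPoisson (m : Measure E) : Measure E :=
  Measure.sum fun k : ℕ =>
    ENNReal.ofReal (Real.exp (-m.real univ) / k.factorial) • convPow m k

theorem lintegral_compoundPoisson (m : Measure E) (f : E → ℝ≥0∞) :
    ∫⁻ y, f y ∂(compoundPoisson m) = ∑' k : ℕ,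
      ENNReal.ofReal (Real.exp (-m.real univ) / k.factorial) * ∫⁻ y, f y ∂(convPow m k) := by
  rw [compoundPoisson, lintegral_sum_measure]
  simp_rw [lintegral_smul_measure, smul_eq_mul]

theorem hasSum_integral_compoundPoisson {F : Type*} [NormedAddCommGroup F] [NormedSpace ℝ F]
    (m : Measure E) {f : E → F} (hf : Integrable f (compoundPoisson m)) :
    HasSum (fun k : ℕ => (Real.exp (-m.real univ) / k.factorial) • ∫ y, f y ∂(convPow m k))
      (∫ y, f y ∂(compoundPoisson m)) := by
  have := hasSum_integral_measure (μ := fun k : ℕ =>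
    ENNReal.ofReal (Real.exp (-m.real univ) / k.factorial) • convPow m k) hf
  convert! this using 2 with k
  rw [integral_smul_measure, ENNReal.toReal_ofReal (by positivity)]

variable [InnerProductSpace ℝ E] [FiniteDimensional ℝ E] [BorelSpace E]

instance convPow_isFiniteMeasure (m : Measure E) [IsFiniteMeasure m] (k : ℕ) :
    IsFiniteMeasure (convPow m k) := by
  induction k with
  | zero => rw [convPow]; infer_instance
  | succ k ih => rw [convPow]; infer_instance

theorem convPow_one (m : Measure E) [SFinite m] : convPow m 1 = m := by
  simp [convPow]

theorem charFun_convPow (m : Measure E) [IsFiniteMeasure m] (k : ℕ) (ξ : E) :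
    charFun (convPow m k) ξ = charFun m ξ ^ k := by
  induction k with
  | zero => simp [convPow]
  | succ k ih => rw [convPow, charFun_conv, ih, pow_succ']

theorem lintegral_convPow_of_mul (m : Measure E) [IsFiniteMeasure m] {f : E → ℝ≥0∞}
    (hf : Measurable f) (h0 : f 0 = 1) (hadd : ∀ x y, f (x + y) = f x * f y) (k : ℕ) :
    ∫⁻ y, f y ∂(convPow m k) = (∫⁻ y, f y ∂m) ^ k := by
  induction k with
  | zero => simp [convPow, h0, lintegral_dirac' _ hf]
  | succ k ih =>
    rw [convPow, Measure.lintegral_conv hf]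
    simp_rw [hadd, lintegral_const_mul _ hf, ih]
    rw [lintegral_mul_const _ hf, pow_succ']

theorem convPow_univ (m : Measure E) [IsFiniteMeasure m] (k : ℕ) :
    convPow m k univ = m univ ^ k := by
  simpa using lintegral_convPow_of_mul m (f := fun _ => 1) measurable_const rfl (by simp) k

theorem lintegral_norm_convPow_le (m : Measure E) [IsFiniteMeasure m] (k : ℕ) :
    ∫⁻ y, ‖y‖ₑ ∂(convPow m k) ≤ k * m univ ^ (k - 1) * ∫⁻ y, ‖y‖ₑ ∂m := by
  induction k with
  | zero => simp [convPow, lintegral_dirac' _ measurable_enorm]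
  | succ k ih =>
    rw [convPow, Measure.lintegral_conv measurable_enorm]
    have h1 : ∀ x : E, ∫⁻ y, ‖x + y‖ₑ ∂(convPow m k) ≤
        ‖x‖ₑ * m univ ^ k + ∫⁻ y, ‖y‖ₑ ∂(convPow m k) := by
      intro x
      refine (lintegral_mono fun y => enorm_add_le x y).trans ?_
      rw [lintegral_add_left measurable_const, lintegral_const, convPow_univ]
    refine (lintegral_mono h1).trans ?_
    rw [lintegral_add_right _ measurable_const, lintegral_mul_const _ measurable_enorm,
      lintegral_const]
    have h2 : (k : ℝ≥0∞) * m univ ^ (k - 1) * m univ = k * m univ ^ k := by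
      rcases k with _ | k
      · simp
      · rw [mul_assoc, ← pow_succ]; simp
    calc (∫⁻ x, ‖x‖ₑ ∂m) * m univ ^ k + (∫⁻ y, ‖y‖ₑ ∂(convPow m k)) * m univ
        ≤ (∫⁻ x, ‖x‖ₑ ∂m) * m univ ^ k +
          (k * m univ ^ (k - 1) * ∫⁻ y, ‖y‖ₑ ∂m) * m univ := by gcongr
      _ = (∫⁻ x, ‖x‖ₑ ∂m) * m univ ^ k +
          (k * m univ ^ (k - 1) * m univ) * ∫⁻ y, ‖y‖ₑ ∂m := by ring
      _ = _ := by rw [h2, Nat.add_sub_cancel]; push_cast; ring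

theorem lintegral_compoundPoisson_of_mul (m : Measure E) [IsFiniteMeasure m] {f : E → ℝ≥0∞}
    (hf : Measurable f) (h0 : f 0 = 1) (hadd : ∀ x y, f (x + y) = f x * f y) {r : ℝ} (hr : 0 ≤ r)
    (hfr : ∫⁻ y, f y ∂m = ENNReal.ofReal r) :
    ∫⁻ y, f y ∂(compoundPoisson m) = ENNReal.ofReal (Real.exp (r - m.real univ)) := by
  rw [lintegral_compoundPoisson]
  simp_rw [lintegral_convPow_of_mul m hf h0 hadd, hfr]
  have h1 : ∀ k : ℕ, ENNReal.ofReal (Real.exp (-m.real univ) / k.factorial) *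
      ENNReal.ofReal r ^ k =
        ENNReal.ofReal (Real.exp (-m.real univ) * (r ^ k / k.factorial)) := by
    intro k
    rw [← ENNReal.ofReal_pow hr, ← ENNReal.ofReal_mul (by positivity)]
    congr 1; ring
  simp_rw [h1]
  have h2 : HasSum (fun k : ℕ => Real.exp (-m.real univ) * (r ^ k / k.factorial))
      (Real.exp (-m.real univ) * Real.exp r) := by
    have := NormedSpace.expSeries_div_hasSum_exp (𝔸 := ℝ) r
    rw [← Real.exp_eq_exp_ℝ] at this
    exact this.mul_left _
  rw [← ENNReal.ofReal_tsum_of_nonneg (fun k => by positivity) h2.summable, h2.tsum_eq,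
    ← Real.exp_add]
  congr 2; ring

instance compoundPoisson_isProbabilityMeasure (m : Measure E) [IsFiniteMeasure m] :
    IsProbabilityMeasure (compoundPoisson m) := by
  refine ⟨?_⟩
  have := lintegral_compoundPoisson_of_mul m (f := fun _ => 1) measurable_const rfl (by simp)
    (r := m.real univ) measureReal_nonneg (by simp [measureReal_def])
  simpa using this

theorem charFun_compoundPoisson (m : Measure E) [IsFiniteMeasure m] (ξ : E) :
    charFun (compoundPoisson m) ξ = Complex.exp (charFun m ξ - m.real univ) := by
  have h := hasSum_integral_compoundPoisson m (f := fun y => Complex.exp (⟪y, ξ⟫_ℝ * Complex.I))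
    ((integrable_const (1 : ℝ)).mono (by fun_prop) (by simp))
  rw [charFun_apply]
  refine h.unique ?_
  simp_rw [← charFun_apply, charFun_convPow]
  have h2 := (NormedSpace.expSeries_div_hasSum_exp (𝔸 := ℂ) (charFun m ξ)).mul_left
    (Complex.exp (-m.real univ))
  rw [← Complex.exp_eq_exp_ℂ, ← Complex.exp_add] at h2
  convert! h2 using 1
  · ext k
    rw [Complex.real_smul]; push_cast; ring
  · congr 1; ring

theorem lintegral_norm_compoundPoisson_le (m : Measure E) [IsFiniteMeasure m] :
    ∫⁻ y, ‖y‖ₑ ∂(compoundPoisson m) ≤ ∫⁻ y, ‖y‖ₑ ∂m := by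
  set L := m.real univ with hL
  have hL0 : 0 ≤ L := measureReal_nonneg
  have hmu : m univ = ENNReal.ofReal L := by simp [hL, measureReal_def]
  rw [lintegral_compoundPoisson]
  have h1 : ∀ k : ℕ, ENNReal.ofReal (Real.exp (-L) / k.factorial) *
      ∫⁻ y, ‖y‖ₑ ∂(convPow m k) ≤
      ENNReal.ofReal (Real.exp (-L) * (k * L ^ (k - 1) / k.factorial)) * ∫⁻ y, ‖y‖ₑ ∂m := by
    intro k
    refine (mul_le_mul_right (lintegral_norm_convPow_le m k) _).trans (le_of_eq ?_)
    rw [hmu, ← ENNReal.ofReal_pow hL0, ← ENNReal.ofReal_natCast,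
      ← mul_assoc, ← ENNReal.ofReal_mul (by positivity), ← ENNReal.ofReal_mul (by positivity)]
    congr 2; ring
  refine (ENNReal.tsum_le_tsum h1).trans ?_
  rw [ENNReal.tsum_mul_right]
  have h2 : HasSum (fun k : ℕ => Real.exp (-L) * (k * L ^ (k - 1) / k.factorial)) 1 := by
    rw [← hasSum_nat_add_iff' 1]
    have := NormedSpace.expSeries_div_hasSum_exp (𝔸 := ℝ) L
    rw [← Real.exp_eq_exp_ℝ] at this
    have := this.mul_left (Real.exp (-L))
    rw [← Real.exp_add] at this
    convert! this using 1
    · funext k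
      rw [Nat.factorial_succ]
      push_cast
      field_simp
    · simp
  rw [← ENNReal.ofReal_tsum_of_nonneg (fun k => by positivity) h2.summable, h2.tsum_eq]
  simp

/-- First-order expansion of a compound Poisson law of small mass: the probability of two jumps or
more is quadratically small. -/
theorem abs_integral_compoundPoisson_sub_le (m : Measure E) [IsFiniteMeasure m] {f : E → ℝ}
    (hf : Continuous f) {B : ℝ} (hB : ∀ y, |f y| ≤ B) :
    |∫ y, f y ∂(compoundPoisson m) - f 0 - ∫ y, (f y - f 0) ∂m| ≤ 4 * B * m.real univ ^ 2 := by
  set L := m.real univ with hL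
  have hL0 : 0 ≤ L := measureReal_nonneg
  have hB0 : 0 ≤ B := (abs_nonneg _).trans (hB 0)
  have hint : ∀ (ν : Measure E) [IsFiniteMeasure ν], Integrable f ν := fun ν _ =>
    (integrable_const B).mono' hf.aestronglyMeasurable (ae_of_all _ fun y => hB y)
  have hs := hasSum_integral_compoundPoisson m (hint (compoundPoisson m))
  have hs1 := NormedSpace.expSeries_div_hasSum_exp (𝔸 := ℝ) L
  rw [← Real.exp_eq_exp_ℝ] at hs1
  have hs1 := hs1.mul_left (Real.exp (-L) * B)
  -- remove the terms with at most one jump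
  have hs2 := (hasSum_nat_add_iff' 2).mpr hs
  have hs3 := (hasSum_nat_add_iff' 2).mpr hs1
  have hbd : ∀ k, |∫ y, f y ∂(convPow m k)| ≤ B * L ^ k := by
    intro k
    have := norm_integral_le_of_norm_le_const (μ := convPow m k) (f := f) (C := B)
      (ae_of_all _ fun y => hB y)
    rw [measureReal_def, convPow_univ, ENNReal.toReal_pow] at this
    exact this
  have hle := tsum_of_norm_bounded hs3 (f := fun k : ℕ =>
    (Real.exp (-m.real univ) / (k + 2).factorial) • ∫ y, f y ∂(convPow m (k + 2))) (by
      intro k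
      rw [norm_smul, Real.norm_eq_abs, Real.norm_eq_abs, abs_of_nonneg (by positivity)]
      refine (mul_le_mul_of_nonneg_left (hbd (k + 2)) (by positivity)).trans (le_of_eq ?_)
      rw [← hL]; ring)
  rw [hs2.tsum_eq, Real.norm_eq_abs] at hle
  have hf0 : ∫ y, f y ∂(convPow m 0) = f 0 := by
    rw [convPow, integral_dirac]
  have e1 : ∫ y, (f y - f 0) ∂m = ∫ y, f y ∂m - L * f 0 := by
    rw [integral_sub (hint m) (integrable_const _)]; simp [hL]
  simp only [Finset.sum_range_succ, Finset.sum_range_zero, hf0, convPow_one, ← hL] at hle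
  simp only [Nat.factorial, smul_eq_mul, pow_zero, pow_one] at hle
  norm_num at hle
  have hm1 := hbd 1
  rw [convPow_one, pow_one] at hm1
  rw [e1]
  have hE : Real.exp (-L) * Real.exp L = 1 := by rw [← Real.exp_add]; simp
  have hexp1 : 1 - L ≤ Real.exp (-L) := by linarith [Real.add_one_le_exp (-L)]
  have hexp2 : Real.exp (-L) ≤ 1 := Real.exp_le_one_iff.mpr (by linarith)
  have hexp3 : Real.exp (-L) * (1 + L) ≤ 1 := by
    nlinarith [Real.add_one_le_exp L, Real.exp_pos (-L)]
  set a := ∫ y, f y ∂m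
  set e := Real.exp (-L)
  set c := ∫ y, f y ∂(compoundPoisson m)
  have hf0 := hB 0
  have hq : 1 - e - e * L ≤ L ^ 2 := by nlinarith
  have k1 : |c - (e * f 0 + e * a)| ≤ B * L ^ 2 := by
    refine hle.trans ?_
    nlinarith
  have k2 : |(1 - e) * a| ≤ L * (B * L) := by
    rw [abs_mul]
    gcongr
    rw [abs_of_nonneg (by linarith)]; linarith
  have k3 : |(e - 1 + L) * f 0| ≤ L ^ 2 * B := by
    rw [abs_mul]
    gcongr
    rw [abs_of_nonneg (by linarith)]
    nlinarith
  have : c - f 0 - (a - L * f 0) = (c - (e * f 0 + e * a)) - (1 - e) * a + (e - 1 + L) * f 0 := by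
    ring
  rw [this]
  refine (abs_add_le _ _).trans ?_
  have := abs_sub (c - (e * f 0 + e * a)) ((1 - e) * a)
  nlinarith

end CompoundPoisson

/-! ### Infinitely divisible laws of finite variation -/

section LevyLaw

theorem norm_cexp_inner_sub_one_le {E : Type*} [NormedAddCommGroup E] [InnerProductSpace ℝ E] (z ξ : E) :
    ‖Complex.exp (⟪z, ξ⟫_ℝ * Complex.I) - 1‖ ≤ ‖ξ‖ * ‖z‖ := by
  rw [mul_comm (⟪z, ξ⟫_ℝ : ℂ)]
  refine (Real.norm_exp_I_mul_ofReal_sub_one_le).trans ?_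
  rw [mul_comm]
  exact norm_inner_le_norm z ξ

variable {E : Type*} [NormedAddCommGroup E] [MeasurableSpace E]

/-- The restriction of a measure to the vectors of norm larger than `1 / (n + 1)`. -/
def largeJumps (m : Measure E) (n : ℕ) : Measure E :=
  m.restrict {z | 1 / ((n : ℝ) + 1) < ‖z‖}

/-- The restriction of a measure to the vectors of norm at most `1 / (n + 1)`. -/
def smallJumps (m : Measure E) (n : ℕ) : Measure E :=
  m.restrict {z | 1 / ((n : ℝ) + 1) < ‖z‖}ᶜ

theorem isFiniteMeasure_largeJumps {m : Measure E} (hm : Integrable (fun z : E => z) m) (n : ℕ) :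
    IsFiniteMeasure (largeJumps m n) :=
  ⟨by
    rw [largeJumps, Measure.restrict_apply_univ]
    exact hm.measure_norm_gt_lt_top (by positivity)⟩

theorem measurableSet_lt_norm [BorelSpace E] (r : ℝ) : MeasurableSet {z : E | r < ‖z‖} :=
  measurableSet_lt measurable_const measurable_norm

theorem largeJumps_add_smallJumps [BorelSpace E] (m : Measure E) (n : ℕ) :
    largeJumps m n + smallJumps m n = m :=
  Measure.restrict_add_restrict_compl (measurableSet_lt_norm _)

theorem tendsto_integral_largeJumps [BorelSpace E] {F : Type*} [NormedAddCommGroup F] [NormedSpace ℝ F]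
    {m : Measure E} {f : E → F} (hf : Integrable f m) (h0 : f 0 = 0) :
    Tendsto (fun n => ∫ z, f z ∂(largeJumps m n)) atTop (𝓝 (∫ z, f z ∂m)) := by
  have hU : (⋃ n : ℕ, {z : E | 1 / ((n : ℝ) + 1) < ‖z‖}) = {0}ᶜ := by
    ext z
    simp only [mem_iUnion, mem_ofPred_eq, mem_compl_iff, mem_singleton_iff]
    refine ⟨fun ⟨n, hn⟩ h => ?_, fun hz => exists_nat_one_div_lt (norm_pos_iff.mpr hz)⟩
    rw [h, norm_zero] at hn
    exact absurd hn (not_lt.mpr (by positivity))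
  have hmono : Monotone fun n : ℕ => {z : E | 1 / ((n : ℝ) + 1) < ‖z‖} := by
    intro n k hnk z hz
    simp only [mem_ofPred_eq] at hz ⊢
    exact lt_of_le_of_lt (Nat.one_div_le_one_div hnk) hz
  have h := tendsto_setIntegral_of_monotone (fun n => measurableSet_lt_norm (E := E) _) hmono
    (f := f) (μ := m) hf.integrableOn
  rw [hU, setIntegral_eq_integral_of_forall_compl_eq_zero (by simpa using h0)] at h
  exact h

theorem tendsto_integral_smallJumps [BorelSpace E] {F : Type*} [NormedAddCommGroup F] [NormedSpace ℝ F]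
    {m : Measure E} {f : E → F} (hf : Integrable f m) (h0 : f 0 = 0) :
    Tendsto (fun n => ∫ z, f z ∂(smallJumps m n)) atTop (𝓝 0) := by
  have h := (tendsto_integral_largeJumps hf h0).const_sub (∫ z, f z ∂m)
  rw [sub_self] at h
  refine h.congr fun n => ?_
  have h1 := integral_add_measure (μ := largeJumps m n) (ν := smallJumps m n) (f := f)
    hf.restrict hf.restrict
  rw [largeJumps_add_smallJumps] at h1
  rw [h1, add_sub_cancel_left]

variable [InnerProductSpace ℝ E]

/-- `ν` is the infinitely divisible law with Lévy measure `m`, without drift or Gaussian part and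
without compensation of the jumps (so that `m` should integrate `‖z‖`): the law at time `1` of the
sum of the jumps of a Poisson point process of intensity `m`. -/
structure IsLevyLaw (m ν : Measure E) : Prop where
  isProbabilityMeasure : IsProbabilityMeasure ν
  charFun_eq : ∀ ξ : E, charFun ν ξ =
    Complex.exp (∫ z, (Complex.exp (⟪z, ξ⟫_ℝ * Complex.I) - 1) ∂m)

theorem isLevyLaw_zero [BorelSpace E] : IsLevyLaw (0 : Measure E) (Measure.dirac 0) :=
  ⟨inferInstance, fun ξ => by simp⟩

variable [FiniteDimensional ℝ E] [BorelSpace E]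

theorem integrable_cexp_inner_sub_one {m : Measure E} (hm : Integrable (fun z : E => z) m) (ξ : E) :
    Integrable (fun z => Complex.exp (⟪z, ξ⟫_ℝ * Complex.I) - 1) m :=
  (hm.norm.const_mul ‖ξ‖).mono' (by fun_prop) (ae_of_all _ fun z => norm_cexp_inner_sub_one_le z ξ)

theorem IsLevyLaw.unique {m ν ν' : Measure E} (h : IsLevyLaw m ν) (h' : IsLevyLaw m ν') :
    ν = ν' := by
  have := h.isProbabilityMeasure
  have := h'.isProbabilityMeasure
  refine Measure.ext_of_charFun (funext fun ξ => ?_)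
  rw [h.charFun_eq, h'.charFun_eq]

theorem IsLevyLaw.conv {m m' ν ν' : Measure E} (h : IsLevyLaw m ν) (h' : IsLevyLaw m' ν')
    (hm : Integrable (fun z : E => z) m) (hm' : Integrable (fun z : E => z) m') :
    IsLevyLaw (m + m') (ν ∗ ν') := by
  have := h.isProbabilityMeasure
  have := h'.isProbabilityMeasure
  refine ⟨inferInstance, fun ξ => ?_⟩
  rw [charFun_conv, h.charFun_eq, h'.charFun_eq, ← Complex.exp_add,
    integral_add_measure (integrable_cexp_inner_sub_one hm ξ) (integrable_cexp_inner_sub_one hm' ξ)]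

theorem isLevyLaw_compoundPoisson (m : Measure E) [IsFiniteMeasure m] :
    IsLevyLaw m (compoundPoisson m) := by
  refine ⟨inferInstance, fun ξ => ?_⟩
  rw [charFun_compoundPoisson, integral_sub _ (integrable_const _), charFun_apply]
  · simp
  · exact (integrable_const (1 : ℝ)).mono (by fun_prop) (by simp)

theorem tendsto_charFun_compoundPoisson_largeJumps {m : Measure E}
    (hm : Integrable (fun z : E => z) m) (ξ : E) :
    Tendsto (fun n => charFun (compoundPoisson (largeJumps m n)) ξ) atTop
      (𝓝 (Complex.exp (∫ z, (Complex.exp (⟪z, ξ⟫_ℝ * Complex.I) - 1) ∂m))) := by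
  have h := tendsto_integral_largeJumps (integrable_cexp_inner_sub_one hm ξ) (by simp)
  refine ((Complex.continuous_exp.tendsto _).comp h).congr fun n => ?_
  have := isFiniteMeasure_largeJumps hm n
  exact ((isLevyLaw_compoundPoisson _).charFun_eq ξ).symm

/-- The Lévy laws of the truncated measures are tight by the continuity of the candidate for the
characteristic function, and any limit point has that characteristic function. -/
theorem exists_isLevyLaw {m : Measure E} (hm : Integrable (fun z : E => z) m) :
    ∃ ν, IsLevyLaw m ν := by
  have hfin := isFiniteMeasure_largeJumps hm
  let P : ℕ → ProbabilityMeasure E := fun n =>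
    ⟨compoundPoisson (largeJumps m n), inferInstance⟩
  have hcont : Continuous fun ξ : E =>
      ∫ z, (Complex.exp (⟪z, ξ⟫_ℝ * Complex.I) - 1) ∂m := by
    rw [continuous_iff_continuousAt]
    intro ξ₀
    refine continuousAt_of_dominated (bound := fun z => (‖ξ₀‖ + 1) * ‖z‖)
      (Eventually.of_forall fun ξ => (integrable_cexp_inner_sub_one hm ξ).1) ?_
      (hm.norm.const_mul _) (ae_of_all _ fun z => by fun_prop)
    filter_upwards [Metric.ball_mem_nhds ξ₀ one_pos] with ξ hξ
    refine ae_of_all _ fun z => (norm_cexp_inner_sub_one_le z ξ).trans ?_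
    gcongr
    have h1 := norm_le_norm_add_norm_sub' ξ ξ₀
    have h2 := mem_ball_iff_norm.mp hξ
    linarith
  have htight : IsTightMeasureSet (range fun n => compoundPoisson (largeJumps m n)) :=
    isTightMeasureSet_of_tendsto_charFun (Complex.continuous_exp.comp hcont).continuousAt
      (tendsto_charFun_compoundPoisson_largeJumps hm)
  have hK : IsCompact (closure (range P)) := by
    refine isCompact_closure_of_isTightMeasureSet (htight.subset ?_)
    rintro _ ⟨_, ⟨n, rfl⟩, rfl⟩
    exact ⟨n, rfl⟩
  let U := hyperfilter ℕ
  obtain ⟨ν, -, hν⟩ := hK.ultrafilter_le_nhds (U.map P)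
    (tendsto_principal.mpr (Eventually.of_forall fun n => subset_closure ⟨n, rfl⟩))
  refine ⟨ν, inferInstance, fun ξ => ?_⟩
  have h1 : Tendsto P U (𝓝 ν) := hν
  rw [ProbabilityMeasure.tendsto_iff_forall_integral_rclike_tendsto ℂ] at h1
  have h2 := h1 (BoundedContinuousFunction.innerProbChar ξ)
  simp_rw [← charFun_eq_integral_innerProbChar] at h2
  exact tendsto_nhds_unique h2 ((tendsto_charFun_compoundPoisson_largeJumps hm ξ).mono_left
    (Nat.hyperfilter_le_atTop))

/-- Lower semicontinuity along the approximation by compound Poisson laws. -/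
theorem IsLevyLaw.lintegral_le_liminf {m ν : Measure E} (h : IsLevyLaw m ν)
    (hm : Integrable (fun z : E => z) m) {f : E → ℝ} (hf : Continuous f) (hf0 : 0 ≤ f) :
    ∫⁻ y, ENNReal.ofReal (f y) ∂ν ≤
      liminf (fun n => ∫⁻ y, ENNReal.ofReal (f y) ∂(compoundPoisson (largeJumps m n))) atTop := by
  have hfin := isFiniteMeasure_largeJumps hm
  have := h.isProbabilityMeasure
  let P : ℕ → ProbabilityMeasure E := fun n =>
    ⟨compoundPoisson (largeJumps m n), inferInstance⟩
  have hP : Tendsto P atTop (𝓝 ⟨ν, inferInstance⟩) := by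
    refine ProbabilityMeasure.tendsto_of_tendsto_charFun fun ξ => ?_
    have := tendsto_charFun_compoundPoisson_largeJumps hm ξ
    rw [← h.charFun_eq ξ] at this
    exact this
  exact lintegral_le_liminf_lintegral_of_forall_isOpen_measure_le_liminf_measure hf hf0
    fun G hG => ProbabilityMeasure.le_liminf_measure_open_of_tendsto hP hG

theorem IsLevyLaw.lintegral_norm_le {m ν : Measure E} (h : IsLevyLaw m ν)
    (hm : Integrable (fun z : E => z) m) :
    ∫⁻ y, ‖y‖ₑ ∂ν ≤ ∫⁻ z, ‖z‖ₑ ∂m := by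
  have hfin := isFiniteMeasure_largeJumps hm
  have h1 := h.lintegral_le_liminf hm continuous_norm fun y => norm_nonneg y
  simp_rw [ofReal_norm] at h1
  refine h1.trans (liminf_le_of_le (by isBoundedDefault) fun b hb => ?_)
  obtain ⟨n, hn⟩ := hb.exists
  exact hn.trans ((lintegral_norm_compoundPoisson_le _).trans
    (lintegral_mono' Measure.restrict_le_self le_rfl))

theorem IsLevyLaw.lintegral_exp_le {m ν : Measure E} (h : IsLevyLaw m ν)
    (hm : Integrable (fun z : E => z) m) {ξ : E}
    (hξ : Integrable (fun z => Real.exp ⟪z, ξ⟫_ℝ - 1) m) :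
    ∫⁻ y, ENNReal.ofReal (Real.exp ⟪y, ξ⟫_ℝ) ∂ν ≤
      ENNReal.ofReal (Real.exp (∫ z, (Real.exp ⟪z, ξ⟫_ℝ - 1) ∂m)) := by
  have hfin := isFiniteMeasure_largeJumps hm
  refine (h.lintegral_le_liminf hm (f := fun y => Real.exp ⟪y, ξ⟫_ℝ) (by fun_prop)
    fun y => (Real.exp_pos _).le).trans (le_of_eq ?_)
  have hlim := tendsto_integral_largeJumps hξ (by simp)
  have hlim2 := (ENNReal.continuous_ofReal.tendsto _).comp ((Real.continuous_exp.tendsto _).comp hlim)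
  refine (hlim2.congr fun n => ?_).liminf_eq
  have hi1 : Integrable (fun z => Real.exp ⟪z, ξ⟫_ℝ - 1) (largeJumps m n) := hξ.restrict
  have hi2 : Integrable (fun z => Real.exp ⟪z, ξ⟫_ℝ) (largeJumps m n) := by
    refine (hi1.add (integrable_const (1 : ℝ))).congr (ae_of_all _ fun z => ?_)
    simp
  have hr : 0 ≤ ∫ z, Real.exp ⟪z, ξ⟫_ℝ ∂(largeJumps m n) :=
    integral_nonneg fun z => (Real.exp_pos _).le
  rw [lintegral_compoundPoisson_of_mul (largeJumps m n) (by fun_prop) (by simp)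
    (fun x y => ?_) hr (ofReal_integral_eq_lintegral_ofReal hi2
      (ae_of_all _ fun z => (Real.exp_pos _).le)).symm]
  · simp only [Function.comp_apply]
    rw [integral_sub hi2 (integrable_const _)]
    simp
  · rw [inner_add_left, Real.exp_add, ENNReal.ofReal_mul (Real.exp_pos _).le]

end LevyLaw

/-! ### The generator determines the semigroup -/

section Uniqueness

variable {d : ℕ}

theorem isCbInfty_comp_inner {φ : ℝ → ℝ} (hφ : ContDiff ℝ ∞ φ)
    (hb : ∀ n x, |iteratedDeriv n φ x| ≤ 1) (ξ : EuclideanSpace ℝ (Fin d)) :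
    IsCbInfty fun x => φ ⟪x, ξ⟫_ℝ := by
  have he : (fun x : EuclideanSpace ℝ (Fin d) => φ ⟪x, ξ⟫_ℝ) = φ ∘ innerSL ℝ ξ := by
    ext x
    simp [real_inner_comm]
  refine ⟨hφ.comp (contDiff_id.inner ℝ contDiff_const), fun n => ⟨∏ _i : Fin n, ‖innerSL ℝ ξ‖, fun x => ?_⟩⟩
  rw [he, ContinuousLinearMap.iteratedFDeriv_comp_right _ hφ x (by exact_mod_cast le_top)]
  refine (ContinuousMultilinearMap.norm_compContinuousLinearMap_le _ _).trans ?_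
  refine mul_le_of_le_one_left (by positivity) ?_
  rw [norm_iteratedFDeriv_eq_norm_iteratedDeriv]
  exact hb n _

theorem isCbInfty_cos_inner (ξ : EuclideanSpace ℝ (Fin d)) :
    IsCbInfty fun x => Real.cos ⟪x, ξ⟫_ℝ :=
  isCbInfty_comp_inner Real.contDiff_cos (fun n x => Real.abs_iteratedDeriv_cos_le_one n x) ξ

theorem isCbInfty_sin_inner (ξ : EuclideanSpace ℝ (Fin d)) :
    IsCbInfty fun x => Real.sin ⟪x, ξ⟫_ℝ :=
  isCbInfty_comp_inner Real.contDiff_sin (fun n x => Real.abs_iteratedDeriv_sin_le_one n x) ξ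

variable {m : Measure (EuclideanSpace ℝ (Fin d))}

/-- The characters are eigenfunctions of the jump operator. -/
theorem jumpOp_cos_add_sin (hm : Integrable (fun z : EuclideanSpace ℝ (Fin d) => z) m)
    (x ξ : EuclideanSpace ℝ (Fin d)) :
    (jumpOp m 1 (fun x => Real.cos ⟪x, ξ⟫_ℝ) x : ℂ) +
        jumpOp m 1 (fun x => Real.sin ⟪x, ξ⟫_ℝ) x * Complex.I =
      Complex.exp (⟪x, ξ⟫_ℝ * Complex.I) *
        ∫ z, (Complex.exp (⟪z, ξ⟫_ℝ * Complex.I) - 1) ∂m := by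
  have hi := (integrable_cexp_inner_sub_one hm ξ).const_mul (Complex.exp (⟪x, ξ⟫_ℝ * Complex.I))
  rw [← integral_const_mul, ← integral_re_add_im hi]
  have h1 : ∀ z, Complex.exp (⟪x, ξ⟫_ℝ * Complex.I) *
      (Complex.exp (⟪z, ξ⟫_ℝ * Complex.I) - 1) =
      (Real.cos ⟪x + (1 : ℝ) • z, ξ⟫_ℝ - Real.cos ⟪x, ξ⟫_ℝ : ℝ) +
      (Real.sin ⟪x + (1 : ℝ) • z, ξ⟫_ℝ - Real.sin ⟪x, ξ⟫_ℝ : ℝ) * Complex.I := by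
    intro z
    rw [mul_sub, ← Complex.exp_add, mul_one, ← add_mul, one_smul, inner_add_left,
      ← Complex.ofReal_add, Complex.exp_mul_I, Complex.exp_mul_I]
    push_cast
    ring
  have hre : ∀ a b : ℝ, RCLike.re ((a : ℂ) + b * Complex.I) = a := by simp
  have him : ∀ a b : ℝ, RCLike.im ((a : ℂ) + b * Complex.I) = b := by simp
  simp only [jumpOp, h1, hre, him]
  rfl

theorem re_integral_cexp_inner_sub_one_nonpos
    (hm : Integrable (fun z : EuclideanSpace ℝ (Fin d) => z) m) (ξ : EuclideanSpace ℝ (Fin d)) :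
    (∫ z, (Complex.exp (⟪z, ξ⟫_ℝ * Complex.I) - 1) ∂m).re ≤ 0 := by
  have h := integral_re (integrable_cexp_inner_sub_one hm ξ)
  simp only [RCLike.re_eq_complex_re] at h
  rw [← h]
  refine integral_nonpos fun z => ?_
  simp only [Complex.sub_re, Complex.exp_ofReal_mul_I_re, Complex.one_re, Pi.zero_apply]
  linarith [Real.cos_le_one ⟪z, ξ⟫_ℝ]

variable {P : ℝ≥0 → Kernel (EuclideanSpace ℝ (Fin d)) (EuclideanSpace ℝ (Fin d))}

/-- The generator, tested on the real and imaginary parts of a character, gives its evolution up to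
`o(t)`, uniformly in the starting point. -/
theorem norm_charFun_sub_le_of_small
    (hm : Integrable (fun z : EuclideanSpace ℝ (Fin d) => z) m)
    (hP : IsMarkovSemigroupOf (jumpOp m 1) P) (ξ : EuclideanSpace ℝ (Fin d)) {ε : ℝ}
    (hε : 0 < ε) :
    ∀ᶠ t : ℝ≥0 in 𝓝[>] 0, ∀ x, ‖charFun (P t x) ξ -
      Complex.exp (t * ∫ z, (Complex.exp (⟪z, ξ⟫_ℝ * Complex.I) - 1) ∂m) *
        Complex.exp (⟪x, ξ⟫_ℝ * Complex.I)‖ ≤ ε * t := by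
  set ψ := ∫ z, (Complex.exp (⟪z, ξ⟫_ℝ * Complex.I) - 1) ∂m with hψ
  have hc := Metric.tendstoUniformly_iff.mp (hP.generator _ (isCbInfty_cos_inner ξ)) (ε / 3)
    (by positivity)
  have hs := Metric.tendstoUniformly_iff.mp (hP.generator _ (isCbInfty_sin_inner ξ)) (ε / 3)
    (by positivity)
  have hcont : Tendsto (fun t : ℝ≥0 => (t : ℝ) * (‖ψ‖ ^ 2 + ‖ψ‖)) (𝓝[>] 0) (𝓝 0) := by
    have : Continuous fun t : ℝ≥0 => (t : ℝ) * (‖ψ‖ ^ 2 + ‖ψ‖) := by fun_prop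
    have := (this.tendsto 0).mono_left (nhdsWithin_le_nhds (s := Ioi 0))
    simpa using this
  filter_upwards [hc, hs, hcont.eventually_lt_const (show (0 : ℝ) < min (ε / 3) 1 by positivity),
    self_mem_nhdsWithin] with t hct hst ht1 (ht0 : 0 < t) x
  have ht : (0 : ℝ) < t := ht0
  obtain ⟨ht2, ht3⟩ := lt_min_iff.mp ht1
  have := hP.markov t
  have hi : Integrable (fun y => Complex.exp (⟪y, ξ⟫_ℝ * Complex.I)) (P t x) :=
    (integrable_const (1 : ℝ)).mono (by fun_prop) (by simp)
  set C := ∫ y, Real.cos ⟪y, ξ⟫_ℝ ∂(P t x)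
  set S := ∫ y, Real.sin ⟪y, ξ⟫_ℝ ∂(P t x)
  have hv : charFun (P t x) ξ = C + S * Complex.I := by
    rw [charFun_apply, ← integral_re_add_im hi]
    simp [Complex.exp_ofReal_mul_I_re, Complex.exp_ofReal_mul_I_im, C, S]
  set e := Complex.exp (⟪x, ξ⟫_ℝ * Complex.I) with he
  have he1 : e = Real.cos ⟪x, ξ⟫_ℝ + Real.sin ⟪x, ξ⟫_ℝ * Complex.I := by
    rw [he, Complex.exp_mul_I]; simp
  have hen : ‖e‖ = 1 := Complex.norm_exp_ofReal_mul_I _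
  have hA := jumpOp_cos_add_sin hm x ξ
  rw [← hψ, ← he] at hA
  have hcx := hct x
  have hsx := hst x
  rw [Real.dist_eq] at hcx hsx
  set A := jumpOp m 1 (fun x => Real.cos ⟪x, ξ⟫_ℝ) x
  set B := jumpOp m 1 (fun x => Real.sin ⟪x, ξ⟫_ℝ) x
  have h1 : ‖charFun (P t x) ξ - e - t * (e * ψ)‖ ≤ t * (ε / 3 + ε / 3) := by
    have heq : charFun (P t x) ξ - e - t * (e * ψ) =
        (-(t : ℝ) : ℂ) * (((A - (t : ℝ)⁻¹ * (C - Real.cos ⟪x, ξ⟫_ℝ) : ℝ) : ℂ) +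
        ((B - (t : ℝ)⁻¹ * (S - Real.sin ⟪x, ξ⟫_ℝ) : ℝ) : ℂ) * Complex.I) := by
      have htc : (t : ℂ) ≠ 0 := by exact_mod_cast ht.ne'
      rw [hv, ← hA, he1]
      push_cast
      field_simp
      ring
    rw [heq, norm_mul, norm_neg, Complex.norm_real, Real.norm_of_nonneg ht.le]
    gcongr
    refine (norm_add_le _ _).trans ?_
    rw [norm_mul, Complex.norm_I, mul_one, Complex.norm_real, Complex.norm_real]
    exact add_le_add hcx.le hsx.le
  have h2 : ‖Complex.exp (t * ψ) - 1 - t * ψ‖ ≤ t * (ε / 3) := by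
    have htψ : ‖(t : ℂ) * ψ‖ = t * ‖ψ‖ := by
      rw [norm_mul]; simp
    refine (Complex.norm_exp_sub_one_sub_id_le ?_).trans ?_
    · rw [htψ]; nlinarith [norm_nonneg ψ, sq_nonneg ‖ψ‖]
    · have : t * ‖ψ‖ ^ 2 ≤ ε / 3 := by nlinarith [norm_nonneg ψ]
      rw [htψ, mul_pow, sq (t : ℝ), mul_assoc]
      gcongr
  have h3 : charFun (P t x) ξ - Complex.exp (t * ψ) * e =
      (charFun (P t x) ξ - e - t * (e * ψ)) - (Complex.exp (t * ψ) - 1 - t * ψ) * e := by ring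
  rw [h3]
  refine (norm_sub_le _ _).trans ?_
  rw [norm_mul, hen, mul_one]
  linarith

/-- Errors in the characteristic function add up along the semigroup. -/
theorem norm_charFun_nsmul_sub_le (hmk : ∀ t, IsMarkovKernel (P t)) (hzero : P 0 = Kernel.id)
    (hadd : ∀ s t, P (s + t) = P t ∘ₖ P s) (ξ : EuclideanSpace ℝ (Fin d)) {c : ℂ} (hc : ‖c‖ ≤ 1)
    {δ : ℝ} {t : ℝ≥0}
    (h : ∀ x, ‖charFun (P t x) ξ - c * Complex.exp (⟪x, ξ⟫_ℝ * Complex.I)‖ ≤ δ) (n : ℕ)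
    (x : EuclideanSpace ℝ (Fin d)) :
    ‖charFun (P (n * t) x) ξ - c ^ n * Complex.exp (⟪x, ξ⟫_ℝ * Complex.I)‖ ≤ n * δ := by
  induction n with
  | zero => simp [hzero, Kernel.id_apply]
  | succ n ih =>
    have hi : ∀ s x, Integrable (fun y => Complex.exp (⟪y, ξ⟫_ℝ * Complex.I)) (P s x) := fun s x =>
      (integrable_const (1 : ℝ)).mono (by fun_prop) (by simp)
    have hi2 : Integrable (fun y => Complex.exp (⟪y, ξ⟫_ℝ * Complex.I))
        ((P t ∘ₖ P (n * t)) x) := by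
      rw [← hadd]; exact hi _ _
    have h1 : charFun (P ((n + 1 : ℕ) * t) x) ξ = ∫ y, charFun (P t y) ξ ∂(P (n * t) x) := by
      rw [show ((n + 1 : ℕ) : ℝ≥0) * t = n * t + t by push_cast; ring, hadd, charFun_apply,
        Kernel.integral_comp hi2]
      rfl
    have h2 : ∫ y, (charFun (P t y) ξ - c * Complex.exp (⟪y, ξ⟫_ℝ * Complex.I)) ∂(P (n * t) x) =
        charFun (P ((n + 1 : ℕ) * t) x) ξ - c * charFun (P (n * t) x) ξ := by
      have hI : Integrable (fun y => charFun (P t y) ξ) (P (n * t) x) := hi2.integral_comp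
      rw [integral_sub hI ((hi _ _).const_mul c), h1, integral_const_mul]
      rfl
    have h3 := norm_integral_le_of_norm_le_const (μ := P (n * t) x) (C := δ) (ae_of_all _ h)
    rw [h2] at h3
    simp only [probReal_univ, mul_one] at h3
    have h4 : charFun (P ((n + 1 : ℕ) * t) x) ξ -
        c ^ (n + 1) * Complex.exp (⟪x, ξ⟫_ℝ * Complex.I) =
        (charFun (P ((n + 1 : ℕ) * t) x) ξ - c * charFun (P (n * t) x) ξ) +
        c * (charFun (P (n * t) x) ξ - c ^ n * Complex.exp (⟪x, ξ⟫_ℝ * Complex.I)) := by ring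
    rw [h4]
    refine (norm_add_le _ _).trans ?_
    rw [norm_mul]
    have h5 := mul_le_mul hc ih (norm_nonneg _) zero_le_one
    have h6 : ((n + 1 : ℕ) : ℝ) * δ = δ + 1 * (n * δ) := by push_cast; ring
    rw [h6]
    exact add_le_add h3 h5

/-- The generator determines the characteristic functions of the transition probabilities. -/
theorem IsMarkovSemigroupOf.charFun_eq
    (hm : Integrable (fun z : EuclideanSpace ℝ (Fin d) => z) m)
    (hP : IsMarkovSemigroupOf (jumpOp m 1) P) (t : ℝ≥0) (x ξ : EuclideanSpace ℝ (Fin d)) :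
    charFun (P t x) ξ =
      Complex.exp (t * ∫ z, (Complex.exp (⟪z, ξ⟫_ℝ * Complex.I) - 1) ∂m) *
        Complex.exp (⟪x, ξ⟫_ℝ * Complex.I) := by
  rcases eq_or_ne t 0 with rfl | ht0
  · simp [hP.zero, Kernel.id_apply]
  have ht : 0 < t := pos_iff_ne_zero.mpr ht0
  set ψ := ∫ z, (Complex.exp (⟪z, ξ⟫_ℝ * Complex.I) - 1) ∂m with hψ
  rw [← sub_eq_zero, ← norm_le_zero_iff]
  refine le_of_forall_pos_le_add fun ε hε => ?_
  have hlim : Tendsto (fun n : ℕ => t / (n + 1 : ℕ)) atTop (𝓝[>] 0) := by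
    refine tendsto_nhdsWithin_iff.mpr ⟨?_, Eventually.of_forall fun n => ?_⟩
    · have h := (tendsto_const_div_atTop_nhds_zero_nat (t : ℝ)).comp (tendsto_add_atTop_nat 1)
      rw [← NNReal.tendsto_coe]
      exact h.congr fun n => by simp
    · exact div_pos ht (by exact_mod_cast n.succ_pos)
  obtain ⟨n, hn⟩ := (hlim.eventually (norm_charFun_sub_le_of_small hm hP ξ
    (show 0 < ε / t by positivity))).exists
  have hc : ‖Complex.exp ((t / (n + 1 : ℕ) : ℝ≥0) * ψ)‖ ≤ 1 := by
    rw [Complex.norm_exp, Real.exp_le_one_iff]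
    have := re_integral_cexp_inner_sub_one_nonpos hm ξ
    rw [← hψ] at this
    have h2 : (((t / (n + 1 : ℕ) : ℝ≥0) : ℂ) * ψ).re = (t / (n + 1 : ℕ) : ℝ≥0) * ψ.re := by
      rw [← Complex.re_ofReal_mul]
    rw [h2]
    exact mul_nonpos_of_nonneg_of_nonpos (NNReal.coe_nonneg _) this
  have key := norm_charFun_nsmul_sub_le hP.markov hP.zero hP.add ξ hc hn (n + 1) x
  have hnt : ((n + 1 : ℕ) : ℝ≥0) * (t / (n + 1 : ℕ)) = t := by field_simp
  rw [hnt, ← Complex.exp_nat_mul, ← mul_assoc] at key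
  have e1 : (((n + 1 : ℕ) : ℂ) * ((t / (n + 1 : ℕ) : ℝ≥0) : ℂ)) = (t : ℂ) := by
    exact_mod_cast congrArg (fun r : ℝ≥0 => ((r : ℝ) : ℂ)) hnt
  have e2 : ((n + 1 : ℕ) : ℝ) * (ε / t * (t / (n + 1 : ℕ) : ℝ≥0)) = ε := by
    push_cast
    have : (t : ℝ) ≠ 0 := by exact_mod_cast ht0
    field_simp
  rw [e1, e2] at key
  linarith

theorem integral_cexp_inner_sub_one_smul {E : Type*} [NormedAddCommGroup E]
    [InnerProductSpace ℝ E] [MeasurableSpace E] (m : Measure E) (t : ℝ≥0) (ξ : E) :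
    ∫ z, (Complex.exp (⟪z, ξ⟫_ℝ * Complex.I) - 1) ∂(t • m) =
      t * ∫ z, (Complex.exp (⟪z, ξ⟫_ℝ * Complex.I) - 1) ∂m := by
  rw [integral_smul_nnreal_measure, NNReal.smul_def, Complex.real_smul]

/-- The transition probabilities are the translates of the Lévy laws of the multiples of `m`. -/
theorem IsMarkovSemigroupOf.eq_dirac_conv
    (hm : Integrable (fun z : EuclideanSpace ℝ (Fin d) => z) m)
    (hP : IsMarkovSemigroupOf (jumpOp m 1) P) {t : ℝ≥0}
    {ν : Measure (EuclideanSpace ℝ (Fin d))} (hν : IsLevyLaw (t • m) ν)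
    (x : EuclideanSpace ℝ (Fin d)) : P t x = Measure.dirac x ∗ ν := by
  have := hν.isProbabilityMeasure
  have := hP.markov t
  refine Measure.ext_of_charFun (funext fun ξ => ?_)
  rw [hP.charFun_eq hm, charFun_conv, charFun_dirac, hν.charFun_eq,
    integral_cexp_inner_sub_one_smul, mul_comm]

end Uniqueness

/-! ### Existence of the semigroup -/

section Existence

section Moments

variable {E : Type*} [NormedAddCommGroup E] [InnerProductSpace ℝ E] [FiniteDimensional ℝ E]
  [MeasurableSpace E] [BorelSpace E] {m ν : Measure E}

theorem IsLevyLaw.integrable (h : IsLevyLaw m ν) (hm : Integrable (fun z : E => z) m) :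
    Integrable (fun z : E => z) ν :=
  ⟨by fun_prop, (h.lintegral_norm_le hm).trans_lt hm.2⟩

theorem IsLevyLaw.integral_norm_le (h : IsLevyLaw m ν) (hm : Integrable (fun z : E => z) m) :
    ∫ y, ‖y‖ ∂ν ≤ ∫ z, ‖z‖ ∂m := by
  rw [integral_norm_eq_lintegral_enorm (by fun_prop), integral_norm_eq_lintegral_enorm (by fun_prop)]
  exact ENNReal.toReal_mono hm.2.ne (h.lintegral_norm_le hm)

/-- The large jumps of a Lévy law form a compound Poisson law, which is expanded to first order in
`t`; the contribution of the small jumps is controlled by their first moment. -/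
theorem IsLevyLaw.abs_integral_sub_le {t : ℝ≥0} (h : IsLevyLaw (t • m) ν)
    (hm : Integrable (fun z : E => z) m) {f : E → ℝ} (hf : Continuous f) {B K : ℝ}
    (hB : ∀ y, |f y| ≤ B) (hK : ∀ x y, |f (x + y) - f x| ≤ K * ‖y‖) (n : ℕ) :
    |∫ y, f y ∂ν - f 0 - t * ∫ z, (f z - f 0) ∂m| ≤
      t * (4 * B * (largeJumps m n).real univ ^ 2 * t + 2 * K * ∫ z, ‖z‖ ∂(smallJumps m n)) := by
  have hfin := isFiniteMeasure_largeJumps hm n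
  have hl : Integrable (fun z : E => z) (largeJumps m n) := hm.restrict
  have hs : Integrable (fun z : E => z) (smallJumps m n) := hm.restrict
  have hl' := hl.smul_measure_nnreal (c := t)
  have hs' := hs.smul_measure_nnreal (c := t)
  obtain ⟨ρ, hρ⟩ := exists_isLevyLaw hs'
  have hρp := hρ.isProbabilityMeasure
  have hν : ν = compoundPoisson (t • largeJumps m n) ∗ ρ := by
    refine h.unique ?_
    have := (isLevyLaw_compoundPoisson (t • largeJumps m n)).conv hρ hl' hs'
    rwa [← smul_add, largeJumps_add_smallJumps] at this
  set κ := compoundPoisson (t • largeJumps m n)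
  have hK0 : ∀ y : E, 0 ≤ K * ‖y‖ := fun y => (abs_nonneg _).trans (hK 0 y)
  have hbi : ∀ (ρ : Measure E) [IsFiniteMeasure ρ], Integrable f ρ := fun ρ _ =>
    (integrable_const B).mono' hf.aestronglyMeasurable (ae_of_all _ hB)
  have hshift : ∀ a, Integrable (fun b => f (a + b)) ρ := fun a =>
    (integrable_const B).mono' (by fun_prop) (ae_of_all _ fun b => hB _)
  have e1 : ∫ y, f y ∂ν = ∫ a, ∫ b, f (a + b) ∂ρ ∂κ := by
    rw [hν, integral_conv (hbi _)]
  have hρK : K * ∫ y, ‖y‖ ∂ρ ≤ t * (K * ∫ z, ‖z‖ ∂(smallJumps m n)) := by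
    have h1 : ∫ z, ‖z‖ ∂(t • smallJumps m n) = t * ∫ z, ‖z‖ ∂(smallJumps m n) := by
      rw [integral_smul_nnreal_measure]; rfl
    have h2 := hρ.integral_norm_le hs'
    rw [h1] at h2
    -- in the zero space `K` may be negative
    by_cases hE : ∃ y : E, y ≠ 0
    · obtain ⟨y, hy⟩ := hE
      have : 0 ≤ K := nonneg_of_mul_nonneg_left (hK0 y) (norm_pos_iff.mpr hy)
      nlinarith
    · push Not at hE
      simp [hE]
  have e2 : |∫ a, ∫ b, f (a + b) ∂ρ ∂κ - ∫ a, f a ∂κ| ≤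
      t * (K * ∫ z, ‖z‖ ∂(smallJumps m n)) := by
    have hI : Integrable (fun a => ∫ b, f (a + b) ∂ρ) κ := by
      refine (integrable_const B).mono' ?_ (ae_of_all _ fun a => ?_)
      · have : StronglyMeasurable (Function.uncurry fun a b : E => f (a + b)) :=
          (show Continuous fun p : E × E => f (p.1 + p.2) by fun_prop).stronglyMeasurable
        exact this.integral_prod_right.aestronglyMeasurable
      · simpa using norm_integral_le_of_norm_le_const (μ := ρ) (C := B)
          (f := fun b => f (a + b)) (ae_of_all _ fun b => hB (a + b))
    rw [← integral_sub hI (hbi κ)]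
    refine le_trans ?_ hρK
    have hb : ∀ a, ‖∫ b, f (a + b) ∂ρ - f a‖ ≤ K * ∫ y, ‖y‖ ∂ρ := by
      intro a
      have : ∫ b, f (a + b) ∂ρ - f a = ∫ b, (f (a + b) - f a) ∂ρ := by
        rw [integral_sub (hshift a) (integrable_const _)]; simp
      rw [this, ← integral_const_mul]
      exact norm_integral_le_of_norm_le ((hρ.integrable hs').norm.const_mul K)
        (ae_of_all _ fun b => hK a b)
    simpa using norm_integral_le_of_norm_le_const (μ := κ) (ae_of_all _ hb)
  have e3 := abs_integral_compoundPoisson_sub_le (t • largeJumps m n) hf hB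
  have e4 : ∫ y, (f y - f 0) ∂(t • largeJumps m n) = t * ∫ y, (f y - f 0) ∂(largeJumps m n) := by
    rw [integral_smul_nnreal_measure]; rfl
  have e5 : (t • largeJumps m n).real univ = t * (largeJumps m n).real univ := by
    exact measureReal_nnreal_smul_apply t
  have hK' : ∀ y, ‖f y - f 0‖ ≤ K * ‖y‖ := fun y => by simpa using hK 0 y
  have hi : Integrable (fun y => f y - f 0) m :=
    (hm.norm.const_mul K).mono' (by fun_prop) (ae_of_all _ hK')
  have e6 : ∫ z, (f z - f 0) ∂m =
      ∫ z, (f z - f 0) ∂(largeJumps m n) + ∫ z, (f z - f 0) ∂(smallJumps m n) := by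
    rw [← integral_add_measure (μ := largeJumps m n) (ν := smallJumps m n) hi.restrict hi.restrict,
      largeJumps_add_smallJumps]
  have e7 : |∫ z, (f z - f 0) ∂(smallJumps m n)| ≤ K * ∫ z, ‖z‖ ∂(smallJumps m n) := by
    rw [← integral_const_mul]
    exact norm_integral_le_of_norm_le (hs.norm.const_mul K) (ae_of_all _ hK')
  rw [e4, e5] at e3
  rw [e1, e6]
  have e8 := mul_le_mul_of_nonneg_left e7 t.coe_nonneg
  rw [abs_le] at e2 e3
  have e9 : |t * ∫ z, (f z - f 0) ∂(smallJumps m n)| ≤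
      t * (K * ∫ z, ‖z‖ ∂(smallJumps m n)) := by
    rw [abs_mul, abs_of_nonneg t.coe_nonneg]; exact e8
  rw [abs_le] at e9 ⊢
  constructor <;> nlinarith [e2.1, e2.2, e3.1, e3.2, e9.1, e9.2]

end Moments

variable {d : ℕ}

theorem IsCbInfty.exists_bound {f : EuclideanSpace ℝ (Fin d) → ℝ} (hf : IsCbInfty f) :
    ∃ B, ∀ x, |f x| ≤ B := by
  obtain ⟨B, hB⟩ := hf.2 0
  exact ⟨B, fun x => by simpa using hB x⟩

theorem IsCbInfty.exists_lipschitz {f : EuclideanSpace ℝ (Fin d) → ℝ} (hf : IsCbInfty f) :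
    ∃ K, ∀ x y, |f (x + y) - f x| ≤ K * ‖y‖ := by
  obtain ⟨K, hK⟩ := hf.2 1
  refine ⟨K, fun x y => ?_⟩
  have h := convex_univ.norm_image_sub_le_of_norm_fderiv_le (𝕜 := ℝ) (f := f) (C := K)
    (fun x _ => (hf.1.differentiable (by simp)).differentiableAt)
    (fun x _ => by simpa using hK x) (mem_univ x) (mem_univ (x + y))
  simpa using h

variable {m : Measure (EuclideanSpace ℝ (Fin d))}

/-- The kernel that adds an independent increment of law `ν`. -/
def translationKernel (ν : Measure (EuclideanSpace ℝ (Fin d))) :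
    Kernel (EuclideanSpace ℝ (Fin d)) (EuclideanSpace ℝ (Fin d)) :=
  (Kernel.id ×ₖ Kernel.const _ ν).map fun p => p.1 + p.2

theorem translationKernel_apply (ν : Measure (EuclideanSpace ℝ (Fin d))) [IsProbabilityMeasure ν]
    (x : EuclideanSpace ℝ (Fin d)) : translationKernel ν x = Measure.dirac x ∗ ν := by
  rw [translationKernel, Kernel.map_apply _ (by fun_prop), Kernel.prod_apply, Kernel.id_apply,
    Kernel.const_apply, Measure.conv]

theorem integral_translationKernel (ν : Measure (EuclideanSpace ℝ (Fin d)))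
    [IsProbabilityMeasure ν] {f : EuclideanSpace ℝ (Fin d) → ℝ} (hf : Continuous f)
    (x : EuclideanSpace ℝ (Fin d)) :
    ∫ y, f y ∂(translationKernel ν x) = ∫ y, f (x + y) ∂ν := by
  rw [translationKernel_apply, Measure.dirac_conv, integral_map (by fun_prop) (by fun_prop)]

theorem translationKernel_comp (ν ν' : Measure (EuclideanSpace ℝ (Fin d)))
    [IsProbabilityMeasure ν] [IsProbabilityMeasure ν'] :
    translationKernel ν' ∘ₖ translationKernel ν = translationKernel (ν ∗ ν') := by
  ext1 x
  rw [translationKernel_apply, ← Measure.conv_assoc]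
  refine Measure.ext_of_lintegral _ fun f hf => ?_
  rw [Kernel.lintegral_comp _ _ _ hf, Measure.lintegral_conv hf, translationKernel_apply]
  refine lintegral_congr fun y => ?_
  rw [translationKernel_apply, Measure.dirac_conv, lintegral_map hf (by fun_prop)]

theorem exists_isMarkovSemigroupOf
    (hm : Integrable (fun z : EuclideanSpace ℝ (Fin d) => z) m) :
    ∃ P, IsMarkovSemigroupOf (jumpOp m 1) P := by
  have hmt : ∀ t : ℝ≥0, Integrable (fun z : EuclideanSpace ℝ (Fin d) => z) (t • m) :=
    fun t => hm.smul_measure_nnreal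
  choose ν hν using fun t => exists_isLevyLaw (hmt t)
  have hp := fun t => (hν t).isProbabilityMeasure
  refine ⟨fun t => translationKernel (ν t), fun t => ⟨fun x => ?_⟩, ?_, fun s t => ?_,
    fun f hf => ?_⟩
  · rw [translationKernel_apply]
    infer_instance
  · have h0 : ν 0 = Measure.dirac 0 := (hν 0).unique (by rw [zero_smul]; exact isLevyLaw_zero)
    ext1 x
    rw [translationKernel_apply, h0, Measure.conv_dirac_zero, Kernel.id_apply]
  · have hst : ν (s + t) = ν s ∗ ν t := by
      refine (hν (s + t)).unique ?_
      rw [add_smul]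
      exact (hν s).conv (hν t) (hmt s) (hmt t)
    rw [translationKernel_comp, hst]
  · obtain ⟨B, hB⟩ := hf.exists_bound
    obtain ⟨K, hK⟩ := hf.exists_lipschitz
    have hfc : Continuous f := hf.1.continuous
    rw [Metric.tendstoUniformly_iff]
    intro ε hε
    have hlim := (tendsto_integral_smallJumps hm.norm (by simp)).const_mul (2 * K)
    rw [mul_zero] at hlim
    obtain ⟨n, hn⟩ := (hlim.eventually_lt_const (half_pos hε)).exists
    have hlim2 : Tendsto (fun t : ℝ≥0 => 4 * B * (largeJumps m n).real univ ^ 2 * (t : ℝ))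
        (𝓝[>] 0) (𝓝 0) := by
      have h1 : Continuous fun t : ℝ≥0 => 4 * B * (largeJumps m n).real univ ^ 2 * (t : ℝ) := by
        fun_prop
      simpa using (h1.tendsto 0).mono_left (nhdsWithin_le_nhds (s := Ioi 0))
    filter_upwards [hlim2.eventually_lt_const (half_pos hε), self_mem_nhdsWithin]
      with t ht (ht0 : 0 < t) x
    have ht0' : (0 : ℝ) < t := ht0
    have key := (hν t).abs_integral_sub_le hm (f := fun y => f (x + y)) (by fun_prop)
      (fun y => hB _) (fun y z => by simpa [add_assoc] using hK (x + y) z) n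
    simp only [add_zero] at key
    rw [integral_translationKernel _ hfc, dist_comm, Real.dist_eq, jumpOp]
    simp only [one_smul]
    set I := ∫ y, f (x + y) ∂(ν t)
    set J := ∫ z, (f (x + z) - f x) ∂m
    have e : (t : ℝ)⁻¹ * (I - f x) - J = (t : ℝ)⁻¹ * (I - f x - t * J) := by field_simp
    rw [e, abs_mul, abs_of_pos (inv_pos.mpr ht0')]
    calc (t : ℝ)⁻¹ * |I - f x - t * J| ≤ (t : ℝ)⁻¹ * (t * _) :=
          mul_le_mul_of_nonneg_left key (inv_pos.mpr ht0').le
      _ = _ := inv_mul_cancel_left₀ ht0'.ne' _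
      _ < ε := by linarith

theorem existsUnique_isMarkovSemigroupOf
    (hm : Integrable (fun z : EuclideanSpace ℝ (Fin d) => z) m) :
    ∃! P, IsMarkovSemigroupOf (jumpOp m 1) P := by
  obtain ⟨P, hP⟩ := exists_isMarkovSemigroupOf hm
  refine ⟨P, hP, fun Q hQ => ?_⟩
  ext1 t
  ext1 x
  obtain ⟨ν, hν⟩ := exists_isLevyLaw (hm.smul_measure_nnreal (c := t))
  rw [hP.eq_dirac_conv hm hν, hQ.eq_dirac_conv hm hν]

end Existence

/-! ### Cramér's bound for convex sets -/

section LargeDeviations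

open scoped Pointwise

variable {E : Type*} [NormedAddCommGroup E] [InnerProductSpace ℝ E] [FiniteDimensional ℝ E]
  [MeasurableSpace E] [BorelSpace E] {m ν : Measure E}

theorem measure_mul_measure_le_conv_add (μ ν : Measure E) [SFinite ν] (A B : Set E) :
    μ A * ν B ≤ (μ ∗ ν) (A + B) := by
  rw [Measure.conv, ← Measure.prod_prod]
  refine (measure_mono ?_).trans (Measure.le_map_apply (by fun_prop) _)
  rintro ⟨a, b⟩ ⟨ha, hb⟩
  exact add_mem_add ha hb

theorem isLevyLaw_convPow (h : IsLevyLaw m ν) (n : ℕ) :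
    IsLevyLaw ((n : ℝ≥0) • m) (convPow ν n) := by
  have := h.isProbabilityMeasure
  refine ⟨⟨by simp [convPow_univ]⟩, fun ξ => ?_⟩
  rw [charFun_convPow, h.charFun_eq, integral_cexp_inner_sub_one_smul, ← Complex.exp_nat_mul]
  simp

/-- Superadditivity: for convex `K`, the mean of `n` independent variables lies in `K` as soon as
all of them do. -/
theorem measure_pow_le_convPow_smul [IsFiniteMeasure ν] {K : Set E} (hK : Convex ℝ K)
    (hne : K.Nonempty) (n : ℕ) : ν K ^ n ≤ convPow ν n ((n : ℝ) • K) := by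
  induction n with
  | zero => simp [convPow, zero_smul_set hne]
  | succ n ih =>
    have h1 : ((n + 1 : ℕ) : ℝ) • K = K + (n : ℝ) • K := by
      push_cast
      rw [add_comm, hK.add_smul zero_le_one n.cast_nonneg, one_smul]
    rw [pow_succ', convPow, h1]
    exact (mul_le_mul_right ih _).trans (measure_mul_measure_le_conv_add _ _ _ _)

/-- The exponential Chebyshev inequality on a half-space. -/
theorem IsLevyLaw.measure_halfSpace_le {n : ℕ} (h : IsLevyLaw ((n : ℝ≥0) • m) ν)
    (hm : Integrable (fun z : E => z) m) {ξ : E}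
    (hξ : Integrable (fun z => Real.exp ⟪z, ξ⟫_ℝ - 1) m) (b : ℝ) :
    ν {y | n * (b + ∫ z, (Real.exp ⟪z, ξ⟫_ℝ - 1) ∂m) ≤ ⟪y, ξ⟫_ℝ} ≤
      ENNReal.ofReal (Real.exp (-b) ^ n) := by
  set F := ∫ z, (Real.exp ⟪z, ξ⟫_ℝ - 1) ∂m
  have h1 := h.lintegral_exp_le hm.smul_measure_nnreal hξ.smul_measure_nnreal
  have h2 : ∫ z, (Real.exp ⟪z, ξ⟫_ℝ - 1) ∂((n : ℝ≥0) • m) = n * F := by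
    rw [integral_smul_nnreal_measure]; rfl
  rw [h2] at h1
  have h3 := meas_ge_le_lintegral_div (μ := ν)
    (f := fun y => ENNReal.ofReal (Real.exp ⟪y, ξ⟫_ℝ)) (by fun_prop)
    (ε := ENNReal.ofReal (Real.exp (n * (b + F))))
    (by simp [Real.exp_pos]) ENNReal.ofReal_ne_top
  refine (measure_mono fun y hy => ?_).trans (h3.trans ?_)
  · exact ENNReal.ofReal_le_ofReal (Real.exp_le_exp.mpr hy)
  · refine (ENNReal.div_le_div_right h1 _).trans (le_of_eq ?_)
    rw [← ENNReal.ofReal_div_of_pos (Real.exp_pos _), ← Real.exp_sub, ← Real.exp_nat_mul]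
    congr 2; ring

/-- A bound with a constant independent of the exponent improves to one without constant. -/
theorem le_of_forall_pow_le_mul_pow {a q N : ℝ} (hq : 0 < q)
    (h : ∀ n : ℕ, a ^ n ≤ N * q ^ n) : a ≤ q := by
  by_contra! hlt
  have h1 : 1 < a / q := (one_lt_div hq).mpr hlt
  obtain ⟨n, hn⟩ := ((tendsto_pow_atTop_atTop_of_one_lt h1).eventually_gt_atTop N).exists
  rw [div_pow, lt_div_iff₀ (by positivity)] at hn
  exact absurd (h n) (not_le.mpr hn)

/-- Cramér's upper bound for compact convex sets, without error term. Covering `K` by finitely many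
half-spaces costs a constant factor, which superadditivity removes. -/
theorem IsLevyLaw.measure_le_of_isCompact_of_convex (h : IsLevyLaw m ν)
    (hm : Integrable (fun z : E => z) m)
    (hexp : ∀ ξ : E, Integrable (fun z => Real.exp ⟪z, ξ⟫_ℝ - 1) m) {K : Set E}
    (hK : IsCompact K) (hKc : Convex ℝ K) {b : ℝ}
    (hb : ∀ y ∈ K, ∃ ξ : E, b < ⟪y, ξ⟫_ℝ - ∫ z, (Real.exp ⟪z, ξ⟫_ℝ - 1) ∂m) :
    ν K ≤ ENNReal.ofReal (Real.exp (-b)) := by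
  have := h.isProbabilityMeasure
  rcases K.eq_empty_or_nonempty with rfl | hne
  · simp
  set F : E → ℝ := fun ξ => ∫ z, (Real.exp ⟪z, ξ⟫_ℝ - 1) ∂m with hF
  obtain ⟨s, hs⟩ := hK.elim_finite_subcover (fun ξ : E => {y : E | b < ⟪y, ξ⟫_ℝ - F ξ})
    (fun ξ => isOpen_lt continuous_const (by fun_prop)) fun y hy => by
      obtain ⟨ξ, hξ⟩ := hb y hy
      exact mem_iUnion.mpr ⟨ξ, hξ⟩
  have hbound : ∀ n : ℕ, ν K ^ n ≤ ENNReal.ofReal (s.card * Real.exp (-b) ^ n) := by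
    intro n
    refine (measure_pow_le_convPow_smul hKc hne n).trans ?_
    have hsub : (n : ℝ) • K ⊆ ⋃ ξ ∈ s, {y : E | n * (b + F ξ) ≤ ⟪y, ξ⟫_ℝ} := by
      rintro _ ⟨y, hy, rfl⟩
      obtain ⟨ξ, hξs, hξ⟩ := mem_iUnion₂.mp (hs hy)
      refine mem_iUnion₂.mpr ⟨ξ, hξs, ?_⟩
      simp only [mem_ofPred_eq, inner_smul_left, conj_trivial] at hξ ⊢
      gcongr
      linarith
    refine (measure_mono hsub).trans ((measure_biUnion_finset_le _ _).trans ?_)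
    refine (Finset.sum_le_sum fun ξ _ =>
      (isLevyLaw_convPow h n).measure_halfSpace_le hm (hexp ξ) b).trans (le_of_eq ?_)
    rw [Finset.sum_const, nsmul_eq_mul, ENNReal.ofReal_mul (by positivity), ENNReal.ofReal_natCast]
  rw [ENNReal.le_ofReal_iff_toReal_le (measure_ne_top _ _) (Real.exp_pos _).le]
  refine le_of_forall_pow_le_mul_pow (N := s.card) (Real.exp_pos _) fun n => ?_
  rw [← ENNReal.toReal_pow]
  exact ENNReal.toReal_le_of_le_ofReal (by positivity) (hbound n)

end LargeDeviations

/-! ### The jump measure -/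

section JumpDensity

variable {α : ℝ} {g : ℝ → ℝ}

theorem IsJumpDensity.aemeasurable (hg : IsJumpDensity α g) : AEMeasurable g := by
  have h := hg.smooth.continuousOn.aemeasurable (μ := volume) (measurableSet_singleton 0).compl
  rwa [Measure.restrict_eq_self_of_ae_mem
    (s := ({0}ᶜ : Set ℝ)) (compl_mem_ae_iff.mpr (measure_singleton 0))] at h

/-- Since `α < 1`, the jumps have a finite first moment. -/
theorem IsJumpDensity.integrable_abs_mul (hg : IsJumpDensity α g) (hα1 : α < 1) :
    Integrable fun z => |z| * g z := by
  obtain ⟨C, hC, hnear⟩ := hg.near_zero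
  obtain ⟨δ, hδ, hball⟩ := Metric.eventually_nhds_iff.mp (eventually_nhdsWithin_iff.mp hnear)
  -- `|z| * g z` is `C * |z| ^ (-α)` near the origin, and at most `δ⁻¹ * z ^ 2 * g z` elsewhere
  let G : ℝ → ℝ := (Ioc 0 δ).indicator fun z => z ^ (-α)
  have hG : Integrable G := by
    refine IntegrableOn.integrable_indicator ?_ measurableSet_Ioc
    exact (intervalIntegrable_iff_integrableOn_Ioc_of_le hδ.le).mp
      (intervalIntegral.intervalIntegrable_rpow' (by linarith))
  have hG0 : ∀ z, 0 ≤ G z := fun z => indicator_nonneg (fun z hz => Real.rpow_nonneg hz.1.le _) z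
  refine (((hG.add hG.comp_neg).const_mul C).add (hg.integrable.const_mul δ⁻¹)).mono'
    (by have := hg.aemeasurable; fun_prop) ?_
  filter_upwards [compl_mem_ae_iff.mpr (measure_singleton (0 : ℝ))] with z hz
  have hz : z ≠ 0 := hz
  have hgz := hg.nonneg z hz
  have hm : 0 ≤ min (z ^ 2) 1 := by positivity
  simp only [Pi.add_apply]
  rw [Real.norm_of_nonneg (by positivity)]
  rcases lt_or_ge |z| δ with hlt | hge
  · have h1 : |z| * g z = C * |z| ^ (-α) := by
      rw [hball (by simpa using hlt) hz, Real.rpow_add (abs_pos.mpr hz), Real.rpow_one,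
        Real.rpow_neg (abs_nonneg z)]
      have := (abs_pos.mpr hz).ne'
      field_simp
    have h2 : |z| ^ (-α) ≤ G z + G (-z) := by
      rcases lt_or_gt_of_ne hz with hneg | hpos
      · have : G (-z) = |z| ^ (-α) := by
          rw [abs_of_neg hneg] at hlt ⊢
          exact indicator_of_mem (s := Ioc 0 δ) ⟨by linarith, hlt.le⟩ _
        linarith [hG0 z]
      · have : G z = |z| ^ (-α) := by
          rw [abs_of_pos hpos] at hlt ⊢
          exact indicator_of_mem (s := Ioc 0 δ) ⟨hpos, hlt.le⟩ _
        linarith [hG0 (-z)]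
    rw [h1]
    have h3 := mul_le_mul_of_nonneg_left h2 hC.le
    have h4 : 0 ≤ δ⁻¹ * (min (z ^ 2) 1 * g z) := by positivity
    linarith
  · have h5 : 0 ≤ C * (G z + G (-z)) := mul_nonneg hC.le (add_nonneg (hG0 _) (hG0 _))
    rcases lt_or_ge 1 |z| with h1 | h1
    · simp [hg.support z h1, h5]
    · have h2 : min (z ^ 2) 1 = |z| * |z| := by
        rw [min_eq_left (by rw [← sq_abs]; nlinarith [abs_nonneg z]), abs_mul_abs_self, sq]
      rw [h2]
      have h3 : |z| * g z ≤ δ⁻¹ * (|z| * |z| * g z) := by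
        rw [← mul_assoc, ← mul_assoc]
        refine mul_le_mul_of_nonneg_right ?_ hgz
        have : 1 ≤ δ⁻¹ * |z| := by rw [inv_mul_eq_div, one_le_div hδ]; exact hge
        nlinarith [abs_nonneg z]
      linarith

variable {d : ℕ} {γ : ℝ → EuclideanSpace ℝ (Fin d)}

theorem IsAdmissibleCurve.exists_norm_le (hγ : IsAdmissibleCurve γ) :
    ∃ K, 0 ≤ K ∧ ∀ z, ‖γ z‖ ≤ K * |z| := by
  obtain ⟨K, hK⟩ := hγ.2.1 1 le_rfl
  refine ⟨K, (norm_nonneg _).trans (hK 0), fun z => ?_⟩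
  have h := convex_univ.norm_image_sub_le_of_norm_deriv_le (f := γ) (C := K)
    (fun x _ => (hγ.1.differentiable (by simp)).differentiableAt)
    (fun x _ => by simpa using hK x) (mem_univ 0) (mem_univ z)
  simpa [hγ.2.2] using h

theorem integrable_levyMeasure (hg : IsJumpDensity α g) (hα1 : α < 1) (hγ : IsAdmissibleCurve γ)
    {F : Type*} [NormedAddCommGroup F] [NormedSpace ℝ F] {f : EuclideanSpace ℝ (Fin d) → F}
    (hf : Continuous f) {K : ℝ} (hK : ∀ z, |z| ≤ 1 → ‖f (γ z)‖ ≤ K * |z|) :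
    Integrable f (levyMeasure γ g) := by
  have hγc : Continuous γ := hγ.1.continuous
  have hgm := hg.aemeasurable
  have hfm : AEStronglyMeasurable f (levyMeasure γ g) := hf.aestronglyMeasurable
  rw [levyMeasure, integrable_map_measure hfm hγc.aemeasurable,
    integrable_withDensity_iff_integrable_smul₀' hgm.ennreal_ofReal
      (ae_of_all _ fun z => ENNReal.ofReal_lt_top)]
  refine ((hg.integrable_abs_mul hα1).const_mul K).mono' ?_ ?_
  · exact (hgm.ennreal_ofReal.ennreal_toReal).aestronglyMeasurable.smul
      (hf.comp hγc).aestronglyMeasurable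
  filter_upwards [compl_mem_ae_iff.mpr (measure_singleton (0 : ℝ))] with z hz
  have hgz := hg.nonneg z hz
  rw [ENNReal.toReal_ofReal hgz, norm_smul, Real.norm_of_nonneg hgz]
  rcases lt_or_ge 1 |z| with h1 | h1
  · simp [hg.support z h1]
  · calc g z * ‖f (γ z)‖ ≤ g z * (K * |z|) := mul_le_mul_of_nonneg_left (hK z h1) hgz
      _ = _ := by ring

theorem integrable_id_levyMeasure (hg : IsJumpDensity α g) (hα1 : α < 1)
    (hγ : IsAdmissibleCurve γ) :
    Integrable (fun z : EuclideanSpace ℝ (Fin d) => z) (levyMeasure γ g) := by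
  obtain ⟨K, -, hK⟩ := hγ.exists_norm_le
  exact integrable_levyMeasure hg hα1 hγ continuous_id fun z _ => hK z

theorem abs_exp_sub_one_le_abs_mul_exp_abs (s : ℝ) : |Real.exp s - 1| ≤ |s| * Real.exp |s| := by
  have h1 := Real.add_one_le_exp (-s)
  have h2 := Real.add_one_le_exp s
  have h3 : Real.exp s * Real.exp (-s) = 1 := by rw [← Real.exp_add]; simp
  have h4 := Real.exp_pos s
  rcases le_total 0 s with hs | hs
  · rw [abs_of_nonneg hs, abs_of_nonneg (by linarith)]
    nlinarith
  · rw [abs_of_nonpos hs, abs_of_nonpos (by linarith [Real.exp_le_one_iff.mpr hs])]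
    nlinarith

/-- The jumps are bounded, so that the Hamiltonian is finite everywhere. -/
theorem integrable_exp_levyMeasure (hg : IsJumpDensity α g) (hα1 : α < 1)
    (hγ : IsAdmissibleCurve γ) (ξ : EuclideanSpace ℝ (Fin d)) :
    Integrable (fun z => Real.exp ⟪z, ξ⟫_ℝ - 1) (levyMeasure γ g) := by
  obtain ⟨K, hK0, hK⟩ := hγ.exists_norm_le
  refine integrable_levyMeasure hg hα1 hγ (K := K * ‖ξ‖ * Real.exp (K * ‖ξ‖)) (by fun_prop)
    fun z hz => ?_
  have h1 : |⟪γ z, ξ⟫_ℝ| ≤ K * ‖ξ‖ * |z| := by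
    refine (abs_real_inner_le_norm _ _).trans ?_
    nlinarith [hK z, norm_nonneg ξ]
  have h2 : K * ‖ξ‖ * |z| ≤ K * ‖ξ‖ := mul_le_of_le_one_right (by positivity) hz
  refine (abs_exp_sub_one_le_abs_mul_exp_abs _).trans ?_
  calc |⟪γ z, ξ⟫_ℝ| * Real.exp |⟪γ z, ξ⟫_ℝ| ≤ K * ‖ξ‖ * |z| * Real.exp (K * ‖ξ‖) := by
        gcongr
        exact h1.trans h2
    _ = _ := by ring

end JumpDensity

/-! ### Scaling and the upper bound for balls -/

section Scaling

variable {d : ℕ} {μ : Measure (EuclideanSpace ℝ (Fin d))}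

/-- The Lévy measure of the process generated by `h⁻¹ L^h`: jumps are multiplied by `h` and occur
`h⁻¹` times as often. -/
def scaledMeasure (μ : Measure (EuclideanSpace ℝ (Fin d))) (h : ℝ) :
    Measure (EuclideanSpace ℝ (Fin d)) :=
  h⁻¹.toNNReal • μ.map fun z => h • z

theorem integral_scaledMeasure {F : Type*} [NormedAddCommGroup F] [NormedSpace ℝ F]
    {h : ℝ} (hh : 0 < h) (f : EuclideanSpace ℝ (Fin d) → F) :
    ∫ z, f z ∂(scaledMeasure μ h) = h⁻¹ • ∫ z, f (h • z) ∂μ := by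
  have he := (Homeomorph.smulOfNeZero (α := EuclideanSpace ℝ (Fin d)) h hh.ne').measurableEmbedding
  rw [scaledMeasure, integral_smul_nnreal_measure, NNReal.smul_def,
    Real.coe_toNNReal _ (inv_nonneg.mpr hh.le)]
  exact congrArg _ (he.integral_map f)

theorem integrable_scaledMeasure {F : Type*} [NormedAddCommGroup F]
    {h : ℝ} (hh : 0 < h) {f : EuclideanSpace ℝ (Fin d) → F}
    (hf : Integrable (fun z => f (h • z)) μ) : Integrable f (scaledMeasure μ h) := by
  have he := (Homeomorph.smulOfNeZero (α := EuclideanSpace ℝ (Fin d)) h hh.ne').measurableEmbedding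
  exact Integrable.smul_measure_nnreal (he.integrable_map_iff.mpr hf)

theorem jumpOp_scaledMeasure {h : ℝ} (hh : 0 < h) :
    (fun (f : EuclideanSpace ℝ (Fin d) → ℝ) x => h⁻¹ * jumpOp μ h f x) =
      jumpOp (scaledMeasure μ h) 1 := by
  ext f x
  rw [jumpOp, jumpOp, integral_scaledMeasure hh]
  simp

theorem integral_exp_scaledMeasure {h : ℝ} (hh : 0 < h) (ξ : EuclideanSpace ℝ (Fin d)) :
    ∫ z, (Real.exp ⟪z, ξ⟫_ℝ - 1) ∂(scaledMeasure μ h) = h⁻¹ * hamiltonian μ (h • ξ) := by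
  rw [integral_scaledMeasure hh, hamiltonian, smul_eq_mul]
  simp_rw [inner_smul_left, inner_smul_right, conj_trivial]

/-- The upper bound for open balls at fixed `h`. An open ball is exhausted by compact balls, so that
the infimum of the Lagrangian over the open ball itself is reached, rather than over its closure. -/
theorem IsMarkovSemigroupOf.measure_ball_le (hμ : Integrable (fun z => z) μ)
    (hexp : ∀ ξ, Integrable (fun z => Real.exp ⟪z, ξ⟫_ℝ - 1) μ) {h : ℝ} (hh : 0 < h)
    {P : ℝ≥0 → Kernel (EuclideanSpace ℝ (Fin d)) (EuclideanSpace ℝ (Fin d))}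
    (hP : IsMarkovSemigroupOf (fun f x => h⁻¹ * jumpOp μ h f x) P)
    {x c : EuclideanSpace ℝ (Fin d)} {r b : ℝ}
    (hb : ∀ y ∈ Metric.ball c r, (b : EReal) < lagrangian μ (y - x)) :
    P 1 x (Metric.ball c r) ≤ ENNReal.ofReal (Real.exp (-(h⁻¹ * b))) := by
  have hm := integrable_scaledMeasure (f := fun z => z) hh (hμ.smul h)
  rw [jumpOp_scaledMeasure hh] at hP
  obtain ⟨ν, hν⟩ := exists_isLevyLaw hm
  have hP1 := hP.eq_dirac_conv hm (t := 1) (by rwa [one_smul]) x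
  have hp := hν.isProbabilityMeasure
  rw [hP1, Measure.dirac_conv, Measure.map_apply (by fun_prop) measurableSet_ball,
    preimage_add_ball, Metric.isOpen_ball.measure_eq_iSup_isCompact]
  refine iSup₂_le fun K hK => iSup_le fun hKc => ?_
  -- a compact subset of the ball lies in a concentric compact ball, which is convex
  obtain ⟨r', hr', hK'⟩ := exists_lt_subset_ball hKc.isClosed hK
  refine (measure_mono (hK'.trans Metric.ball_subset_closedBall)).trans ?_
  refine hν.measure_le_of_isCompact_of_convex hm (fun ξ => integrable_scaledMeasure hh ?_)
    (isCompact_closedBall _ _) (convex_closedBall _ _) fun y hy => ?_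
  · simpa only [inner_smul_left, inner_smul_right, conj_trivial] using hexp (h • ξ)
  · have hy' : y + x ∈ Metric.ball c r := by
      rw [mem_closedBall_iff_norm] at hy
      rw [mem_ball_iff_norm]
      refine lt_of_le_of_lt (le_of_eq_of_le ?_ hy) hr'
      congr 1; abel
    have h1 := hb _ hy'
    rw [add_sub_cancel_right, lagrangian, lt_iSup_iff] at h1
    obtain ⟨ξ, hξ⟩ := h1
    refine ⟨h⁻¹ • ξ, ?_⟩
    rw [integral_exp_scaledMeasure hh, smul_inv_smul₀ hh.ne', inner_smul_right, ← mul_sub]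
    exact mul_lt_mul_of_pos_left (by exact_mod_cast hξ) (inv_pos.mpr hh)

/-- The straight segment is a competitor in the definition of the cost. -/
theorem cost_le_lagrangian (μ : Measure (EuclideanSpace ℝ (Fin d)))
    (x y : EuclideanSpace ℝ (Fin d)) : (cost μ x y : EReal) ≤ lagrangian μ (y - x) := by
  rw [← EReal.coe_toENNReal (lagrangian_nonneg μ (y - x)), EReal.coe_ennreal_le_coe_ennreal_iff]
  have hpc : IsPiecewiseC1 fun t : ℝ => x + t • (y - x) := by
    refine ⟨1, ![0, 1], ?_, by simp, by simp, fun i => ContDiff.contDiffOn (by fun_prop)⟩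
    refine Fin.strictMono_iff_lt_succ.mpr fun i => ?_
    fin_cases i
    simp
  have hderiv : ∀ t : ℝ, deriv (fun t : ℝ => x + t • (y - x)) t = y - x := fun t => by
    simpa using (((hasDerivAt_id t).smul_const (y - x)).const_add x).deriv
  refine (iInf₂_le _ ⟨hpc, by simp, by simp⟩).trans (le_of_eq ?_)
  simp [action, hderiv]

/-- The large deviation upper bound holds for each `h > 0`, without error term. -/
theorem IsMarkovSemigroupOf.mul_log_measure_ball_le (hμ : Integrable (fun z => z) μ)
    (hexp : ∀ ξ, Integrable (fun z => Real.exp ⟪z, ξ⟫_ℝ - 1) μ) {h : ℝ} (hh : 0 < h)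
    {P : ℝ≥0 → Kernel (EuclideanSpace ℝ (Fin d)) (EuclideanSpace ℝ (Fin d))}
    (hP : IsMarkovSemigroupOf (fun f x => h⁻¹ * jumpOp μ h f x) P)
    (x c : EuclideanSpace ℝ (Fin d)) (r : ℝ) :
    (h : EReal) * ENNReal.log (P 1 x (Metric.ball c r)) ≤
      -(⨅ y ∈ Metric.ball c r, (cost μ x y : EReal)) := by
  by_contra! hlt
  obtain ⟨b, hb1, hb2⟩ := EReal.lt_iff_exists_real_btwn.mp hlt
  have hb3 : ((-b : ℝ) : EReal) < ⨅ y ∈ Metric.ball c r, (cost μ x y : EReal) := by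
    rw [EReal.coe_neg]; exact EReal.neg_lt_comm.mp hb1
  have h1 := hP.measure_ball_le hμ hexp hh (x := x) (c := c) (r := r)
    (b := -b) fun y hy => hb3.trans_le ((iInf₂_le y hy).trans (cost_le_lagrangian μ x y))
  have h2 := ENNReal.log_monotone h1
  rw [ENNReal.log_ofReal_of_pos (Real.exp_pos _), Real.log_exp] at h2
  have h3 := mul_le_mul_of_nonneg_left h2 (show (0 : EReal) ≤ h by exact_mod_cast hh.le)
  rw [← EReal.coe_mul, show h * -(h⁻¹ * -b) = b by field_simp] at h3
  exact absurd hb2 (not_lt.mpr h3)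

end Scaling

end

end JumpLD

theorem theorem1 (d : ℕ) (α : ℝ) (hα0 : 0 < α) (hα1 : α < 1)
    (g : ℝ → ℝ) (hg : JumpLD.IsJumpDensity α g)
    (γ : ℝ → EuclideanSpace ℝ (Fin d)) (hγ : JumpLD.IsAdmissibleCurve γ)
    (hH : JumpLD.HypothesisH γ) :
    (∀ h : ℝ, 0 < h →
      ∃! P : ℝ≥0 → Kernel (EuclideanSpace ℝ (Fin d)) (EuclideanSpace ℝ (Fin d)),
        JumpLD.IsMarkovSemigroupOf
          (fun f x => h⁻¹ * JumpLD.jumpOp (JumpLD.levyMeasure γ g) h f x) P) ∧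
    ∀ P : ℝ → ℝ≥0 → Kernel (EuclideanSpace ℝ (Fin d)) (EuclideanSpace ℝ (Fin d)),
      (∀ h : ℝ, 0 < h →
        JumpLD.IsMarkovSemigroupOf
          (fun f x => h⁻¹ * JumpLD.jumpOp (JumpLD.levyMeasure γ g) h f x) (P h)) →
      ∀ (x c : EuclideanSpace ℝ (Fin d)) (r : ℝ), 0 < r →
        limsup (fun h : ℝ => (h : EReal) * ENNReal.log (P h 1 x (Metric.ball c r))) (𝓝[>] 0) ≤
          -(⨅ y ∈ Metric.ball c r, (JumpLD.cost (JumpLD.levyMeasure γ g) x y : EReal)) := by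
  have hμ := JumpLD.integrable_id_levyMeasure hg hα1 hγ
  have hexp := JumpLD.integrable_exp_levyMeasure hg hα1 hγ
  refine ⟨fun h hh => ?_, fun P hP x c r _ => ?_⟩
  · rw [JumpLD.jumpOp_scaledMeasure hh]
    exact JumpLD.existsUnique_isMarkovSemigroupOf
      (JumpLD.integrable_scaledMeasure (f := fun z => z) hh (hμ.smul h))
  · refine limsup_le_of_le (by isBoundedDefault) ?_
    filter_upwards [self_mem_nhdsWithin] with h hh
    exact (hP h hh).mul_log_measure_ball_le hμ hexp hh x c r
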